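/- Let $G$ and $H$ be locally compact second countable Hausdorff abelian groups with fixed Haar measures $m_G$, $m_H$, and put $L = G\times H$, $m_L = m_G\otimes m_H$. Let $\Gamma<L$ be a lattice (a discrete subgroup having a Borel fundamental domain $\mathcal F$ with $\mathrm{covol}(\Gamma):=m_L(\mathcal F)<\infty$) which projects injectively to $G$ and densely to $H$, and let $W\subset H$ be a relatively compact Borel set whose interior is dense in $W$. Let $\mathbb P$ be the unique probability measure on $\Omega=\Gamma\backslash L$ which is invariant under the action $a.\Gamma(g,h)=\Gamma(ga^{-1},h)$ of $G$, and let $$p=p(G,H,\Gamma,W):\ \Gamma(g,h)\longmapsto \sum_{x\in\Lambda_{\Gamma(g,h)}}\delta_x,\qquad \Lambda_{\Gamma(g,h)}=\mathrm{pr}_G\bigl(\Gamma\cap(G\times Wh^{-1})\bigr)\,g .$$ Write $\widehat f(\chi)=\int_G f\,\overline{\chi}\,dm_G$ for functions on $G$ (similarly on $H$), and $f^*(x)=\overline{f(x^{-1})}$. The autocorrelation $\eta^+_p$ of $p$ is the Radon measure on $G$ given by $$\mathbb E\bigl[(p_\omega\otimes p_\omega)(F)\bigr]=\int_G\int_G F(xg,g)\,dm_G(g)\,d\eta_p^+(x)$$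 for all Borel $F\ge 0$ on $G\times G$, the intensity $i(p)$ is given by $\mathbb E[p_\omega(A)]=i(p)\,m_G(A)$ for all Borel $A\subset G$, and the centered autocorrelation is $\eta_p=\eta_p^+-i(p)^2m_G$. The diffraction $\widehat\eta_p^+$ and the centered diffraction $\widehat\eta_p$ are the Fourier transforms of $\eta_p^+$ and $\eta_p$, i.e. the unique positive Radon measures on $\widehat G$ with $\widehat\eta_p^+(|\widehat f|^2)=\eta_p^+(f*f^*)$, respectively $\widehat\eta_p(|\widehat f|^2)=\eta_p(f*f^*)$, for all $f\in C_c(G)$. Let $\Gamma^\perp=\{(\xi_1,\xi_2)\in\widehat G\times\widehat H:\ \xi_1(\gamma_1)\xi_2(\gamma_2)=1\text{ for all }(\gamma_1,\gamma_2)\in\Gamma\}$. Then $p$ is a locally square-integrable $G$-invariant random measure, its diffraction and centered diffraction exist and are unique, and $$\widehat\eta_p^+=\frac1{\mathrm{covol}(\Gamma)^2}\sum_{(\xi_1,\xi_2)\in\Gamma^\perp}|\widehat\chi_W(\xi_2)|^2\,\delta_{\xi_1},\qquad \widehat\eta_p=\frac1{\mathrm{covol}(\Gamma)^2}\sum_{(\xi_1,\xi_2)\in\Gamma^\perp\setminus\{(0,0)\}}|\widehat\chi_W(\xi_2)|^2\,\delta_{\xi_1},$$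 where $(0,0)$ denotes the pair of trivial characters. -/

import Mathlib

open MeasureTheory
open scoped ENNReal NNReal

noncomputable section

namespace CutProject

section RandomMeasures

variable {G : Type*} [CommGroup G] [TopologicalSpace G] [MeasurableSpace G]
variable {Ω : Type*} [MeasurableSpace Ω] [MulAction G Ω]

/-- A locally square-integrable invariant (positive) random measure on `G`: a probability
measure preserving measurable action of `G` on `(Ω, P)` and a measurable equivariant map `p`
from `Ω` to the Radon measures on `G`, where `g` acts on `G` by `x ↦ x * g⁻¹`, such that
`𝔼[p_ω(B)²] < ∞` for every bounded Borel set `B`. On a locally compact second countable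
group the Radon measures are the Borel measures that are finite on compact sets. -/
structure IsInvariantRandomMeasure (P : Measure Ω) (p : Ω → Measure G) : Prop where
  isProbabilityMeasure : IsProbabilityMeasure P
  measurable_smul : Measurable (fun x : G × Ω => x.1 • x.2)
  measurePreserving_smul : ∀ g : G, MeasurePreserving (fun ω : Ω => g • ω) P P
  measurable : Measurable p
  isFiniteMeasureOnCompacts : ∀ ω, IsFiniteMeasureOnCompacts (p ω)
  equivariant : ∀ (g : G) (ω : Ω), p (g • ω) = (p ω).map (fun x => x * g⁻¹)
  locallySquareIntegrable : ∀ B : Set G, MeasurableSet B → (∃ K, IsCompact K ∧ B ⊆ K) →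
    ∫⁻ ω, (p ω B) ^ 2 ∂P < ∞

/-- The first moment `M¹_p(A) = 𝔼[p_ω(A)]`. -/
def firstMoment (P : Measure Ω) (p : Ω → Measure G) (A : Set G) : ℝ≥0∞ :=
  ∫⁻ ω, p ω A ∂P

/-- The second moment `M²_p(B) = 𝔼[(p_ω ⊗ p_ω)(B)]`. -/
def secondMoment (P : Measure Ω) (p : Ω → Measure G) (B : Set (G × G)) : ℝ≥0∞ :=
  ∫⁻ ω, ((p ω).prod (p ω)) B ∂P

/-- `i` is the intensity of `p` with respect to the Haar measure `mG`: `M¹_p = i • mG`. -/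
def IsIntensity (mG : Measure G) (P : Measure Ω) (p : Ω → Measure G) (i : ℝ≥0) : Prop :=
  ∀ A : Set G, MeasurableSet A → firstMoment P p A = i * mG A

/-- `η` is the autocorrelation `η⁺_p` of `p`: the Radon measure on `G` that corresponds to the
`G`-invariant measure `M²_p` under the identification `(G × G) / Δ(G) ≅ G`,
`[(g₁, g₂)] ↦ g₁ g₂⁻¹`, that is, `∫ F dM²_p = ∫∫ F(xg, g) dmG(g) dη(x)`. -/
def IsAutocorrelation (mG : Measure G) (P : Measure Ω) (p : Ω → Measure G)
    (η : Measure G) : Prop :=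
  IsFiniteMeasureOnCompacts η ∧
    ∀ B : Set (G × G), MeasurableSet B →
      secondMoment P p B = ((η.prod mG).map (fun x : G × G => (x.1 * x.2, x.2))) B

/-- Convolution of functions on `G`. -/
def conv (mG : Measure G) (f g : G → ℂ) (x : G) : ℂ :=
  ∫ y, f y * g (y⁻¹ * x) ∂mG

/-- The involution `f*(x) = conj (f (x⁻¹))`. -/
def involution (f : G → ℂ) (x : G) : ℂ :=
  (starRingEnd ℂ) (f x⁻¹)

/-- The Fourier transform `f̂(χ) = ∫ f(x) conj (χ x) dmG(x)` on the Pontryagin dual. -/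
def fourier [IsTopologicalGroup G] (mG : Measure G) (f : G → ℂ) (χ : PontryaginDual G) : ℂ :=
  ∫ x, f x * (starRingEnd ℂ) (χ x : ℂ) ∂mG

/-- `σ` is the Fourier transform of the positive definite (signed) Radon measure on `G` whose
integration functional on `C_c(G)` is `Φ`: the positive Radon measure `σ` on the dual group such
that `σ(|f̂|²) = Φ(f * f*)` for every `f ∈ C_c(G)`. -/
def IsFourierTransform [IsTopologicalGroup G] [MeasurableSpace (PontryaginDual G)]
    (mG : Measure G) (Φ : (G → ℂ) → ℂ) (σ : Measure (PontryaginDual G)) : Prop :=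
  IsFiniteMeasureOnCompacts σ ∧
    ∀ f : G → ℂ, Continuous f → HasCompactSupport f →
      Integrable (fun χ => ‖fourier mG f χ‖ ^ 2) σ ∧
        ((∫ χ, ‖fourier mG f χ‖ ^ 2 ∂σ : ℝ) : ℂ) = Φ (conv mG f (involution f))

/-- `σ` is the diffraction of the invariant random measure `p`: the Fourier transform of its
autocorrelation `η⁺_p`. -/
def IsDiffraction [IsTopologicalGroup G] [MeasurableSpace (PontryaginDual G)]
    (mG : Measure G) (P : Measure Ω) (p : Ω → Measure G)
    (σ : Measure (PontryaginDual G)) : Prop :=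
  IsInvariantRandomMeasure P p ∧
    ∃ η : Measure G, IsAutocorrelation mG P p η ∧
      IsFourierTransform mG (fun f => ∫ x, f x ∂η) σ

/-- `σ` is the centered diffraction of the invariant random measure `p`: the Fourier transform of
its centered autocorrelation `η_p = η⁺_p - i(p)² mG`. -/
def IsCenteredDiffraction [IsTopologicalGroup G] [MeasurableSpace (PontryaginDual G)]
    (mG : Measure G) (P : Measure Ω) (p : Ω → Measure G)
    (σ : Measure (PontryaginDual G)) : Prop :=
  IsInvariantRandomMeasure P p ∧
    ∃ (η : Measure G) (i : ℝ≥0), IsAutocorrelation mG P p η ∧ IsIntensity mG P p i ∧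
      IsFourierTransform mG
        (fun f => ∫ x, f x ∂η - ((i : ℝ) : ℂ) ^ 2 * ∫ x, f x ∂mG) σ

end RandomMeasures

section CutAndProject

variable {G H : Type*} [CommGroup G] [CommGroup H]

/-- `Γ` is a lattice in the group `L` with Haar measure `m`: a discrete subgroup that has a
fundamental domain of finite measure. -/
structure IsLattice {L : Type*} [Group L] [TopologicalSpace L] [MeasurableSpace L]
    (m : Measure L) (Γ : Subgroup L) : Prop where
  discrete : DiscreteTopology Γ
  exists_isFundamentalDomain : ∃ F : Set L, MeasurableSet F ∧ IsFundamentalDomain Γ F m ∧ m F < ∞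

/-- The covolume of `Γ`: the measure of a fundamental domain. -/
def covol {L : Type*} [Group L] [MeasurableSpace L] (m : Measure L) (Γ : Subgroup L) : ℝ≥0∞ :=
  covolume Γ L m

/-- The action of `G` on `Γ \ (G × H)` given by `a.(Γ(g, h)) = Γ(g a⁻¹, h)`. -/
instance quotientAction (Γ : Subgroup (G × H)) : MulAction G ((G × H) ⧸ Γ) where
  smul a ω := (a⁻¹, (1 : H)) • ω
  one_smul ω := by
    change ((1 : G)⁻¹, (1 : H)) • ω = ω
    rw [inv_one]
    exact one_smul (G × H) ω
  mul_smul a b ω := by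
    change ((a * b)⁻¹, (1 : H)) • ω = (a⁻¹, (1 : H)) • (b⁻¹, (1 : H)) • ω
    rw [smul_smul, Prod.mk_mul_mk, one_mul, mul_inv]

/-- The cut-and-project set `Λ(G, H, Γ, W) = pr_G(Γ ∩ (G × W))`. -/
def modelSet (Γ : Subgroup (G × H)) (W : Set H) : Set G :=
  Prod.fst '' ((Γ : Set (G × H)) ∩ Set.univ ×ˢ W)

/-- The translate `Λ(G, H, Γ, W h⁻¹) g`. -/
def translatedModelSet (Γ : Subgroup (G × H)) (W : Set H) (l : G × H) : Set G :=
  (fun x => x * l.1) '' modelSet Γ ((fun w => w * l.2⁻¹) '' W)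

lemma mem_translatedModelSet (Γ : Subgroup (G × H)) (W : Set H) (l : G × H) (x : G) :
    x ∈ translatedModelSet Γ W l ↔ ∃ γ ∈ Γ, γ.1 * l.1 = x ∧ γ.2 * l.2 ∈ W := by
  constructor
  · rintro ⟨_, ⟨γ, ⟨hγ, -, w, hw, hwγ⟩, rfl⟩, rfl⟩
    refine ⟨γ, hγ, rfl, ?_⟩
    rw [← hwγ]
    simpa using hw
  · rintro ⟨γ, hγ, rfl, hw⟩
    exact ⟨γ.1, ⟨γ, ⟨hγ, Set.mem_univ _, _, hw, by simp⟩, rfl⟩, rfl⟩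

/-- The random set `Λ_{Γ(g, h)} = Λ(G, H, Γ, W h⁻¹) g`, as a function on `Γ \ (G × H)`. -/
def randomModelSet (Γ : Subgroup (G × H)) (W : Set H) (ω : (G × H) ⧸ Γ) : Set G :=
  Quotient.liftOn' ω (translatedModelSet Γ W) (by
    intro a b hab
    rw [QuotientGroup.leftRel_apply] at hab
    have key : ∀ c d : G × H, c⁻¹ * d ∈ Γ →
        translatedModelSet Γ W d ⊆ translatedModelSet Γ W c := by
      intro c d h x hx
      rw [mem_translatedModelSet] at hx ⊢
      obtain ⟨γ, hγ, h1, h2⟩ := hx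
      refine ⟨γ * (c⁻¹ * d), Γ.mul_mem hγ h, ?_, ?_⟩
      · rw [← h1]
        simp only [Prod.fst_mul, Prod.fst_inv]
        rw [mul_assoc, mul_comm (c.1⁻¹), mul_assoc, inv_mul_cancel, mul_one]
      · have : (γ * (c⁻¹ * d)).2 * c.2 = γ.2 * d.2 := by
          simp only [Prod.snd_mul, Prod.snd_inv]
          rw [mul_assoc, mul_comm (c.2⁻¹), mul_assoc, inv_mul_cancel, mul_one]
        rwa [this]
    refine Set.Subset.antisymm (key b a ?_) (key a b hab)
    have := Γ.inv_mem hab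
    rwa [mul_inv_rev, inv_inv] at this)

/-- The measure `δ_Λ = ∑_{x ∈ Λ} δ_x`. -/
def diracComb [MeasurableSpace G] (Λ : Set G) : Measure G :=
  Measure.sum (fun x : Λ => Measure.dirac (x : G))

/-- The cut-and-project process `p(G, H, Γ, W) : Γ(g, h) ↦ δ_{Λ(G, H, Γ, W h⁻¹) g}`. -/
def process [MeasurableSpace G] (Γ : Subgroup (G × H)) (W : Set H) (ω : (G × H) ⧸ Γ) :
    Measure G :=
  diracComb (randomModelSet Γ W ω)

variable [TopologicalSpace G] [IsTopologicalGroup G] [TopologicalSpace H] [IsTopologicalGroup H]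

/-- The dual lattice `Γ^⊥` in `Ĝ × Ĥ`, where `(ξ₁, ξ₂)` is the character
`(g, h) ↦ ξ₁(g) ξ₂(h)` of `G × H`. -/
def dualLattice (Γ : Subgroup (G × H)) : Set (PontryaginDual G × PontryaginDual H) :=
  {ξ | ∀ γ ∈ Γ, ξ.1 γ.1 * ξ.2 γ.2 = 1}

/-- The measure `covol(Γ)⁻² ∑_{ξ ∈ S} |χ̂_W(ξ₂)|² δ_{ξ₁}` on `Ĝ`. -/
def spectralSum [MeasurableSpace G] [MeasurableSpace H] [MeasurableSpace (PontryaginDual G)]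
    (mG : Measure G) (mH : Measure H) (Γ : Subgroup (G × H)) (W : Set H)
    (S : Set (PontryaginDual G × PontryaginDual H)) : Measure (PontryaginDual G) :=
  ((covol (mG.prod mH) Γ) ^ 2)⁻¹ •
    Measure.sum (fun ξ : S =>
      ENNReal.ofReal (‖fourier mH (W.indicator fun _ => (1 : ℂ)) ξ.1.2‖ ^ 2) •
        Measure.dirac ξ.1.1)

end CutAndProject

end CutProject

end

set_option linter.unusedSectionVars false

noncomputable section

/-! For f ∈ C_c(G), the defining identity of an autocorrelation η of p gives η(f * f*) = 𝔼|p_ω(f)|²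
(`IsAutocorrelation.integral_conv`), so the diffraction is read off from the L²-norm of ω ↦ p_ω(f).
Since Γ projects densely to H, the G-invariant measure P is invariant under all translations of the
abelian group Ω = L/Γ (`isMulLeftInvariant_of_measurePreserving`). A locally compact group with a
finite invariant measure is compact (`compactSpace_quotient`), so P is the Haar probability measure
of a compact abelian group whose dual is Γ^⊥ (`bijective_restrictChar`).

Parseval's identity now expands 𝔼|p_ω(f)|² over Γ^⊥. Because p_ω(f) is the sum of f ⊗ χ_W over the
coset ω, unfolding (`unfoldMeasure_eq`) turns its Fourier coefficient at ξ into an integral over L,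
equal to covol(Γ)⁻¹ f̂(ξ₁) χ̂_W(ξ₂). The sum of the squared moduli is the integral of |f̂|² against
the spectral sum. The intensity is m_H(W)/covol(Γ), so the term of the trivial pair is i(p)²|∫ f|² =
i(p)² m_G(f * f*), which is what centering removes.

Parseval rests on Peter–Weyl for compact abelian groups (`charSpan_orthogonal`): a nonzero
eigenspace of a compact convolution operator on the orthogonal complement of the characters would
contain a joint eigenvector of all translations, which is a multiple of a character. Uniqueness of
the diffraction (`IsFourierTransform.unique`) follows by polarization, since a finite measure on the
dual is determined by its integrals of x ↦ χ(x). -/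

namespace CutProject

/-! ### Joint eigenvectors of commuting operators -/

section JointEigenvector

/-- A commuting family of endomorphisms of a nonzero finite-dimensional complex vector space has a
joint eigenvector. -/
lemma exists_joint_eigenvector {ι : Type*} (n : ℕ) : ∀ {E : Type*} [AddCommGroup E] [Module ℂ E]
    [FiniteDimensional ℂ E] [Nontrivial E] (_ : Module.finrank ℂ E ≤ n) (R : ι → E →ₗ[ℂ] E)
    (_ : ∀ i j v, R i (R j v) = R j (R i v)), ∃ v : E, v ≠ 0 ∧ ∀ i, ∃ c : ℂ, R i v = c • v := by
  induction n with
  | zero =>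
    intro E _ _ _ _ hn R hR
    have := Module.finrank_pos (R := ℂ) (M := E)
    omega
  | succ n ih =>
    intro E _ _ _ _ hn R hR
    -- If some operator is not scalar, one of its eigenspaces is proper and nonzero; the whole
    -- family preserves it by commutation, so the induction applies there.
    by_cases h : ∀ i, ∃ c : ℂ, ∀ v, R i v = c • v
    · obtain ⟨v, hv⟩ := exists_ne (0 : E)
      exact ⟨v, hv, fun i => ⟨(h i).choose, (h i).choose_spec v⟩⟩
    · push Not at h
      obtain ⟨i, hi⟩ := h
      obtain ⟨c, hc⟩ := Module.End.exists_eigenvalue (R i)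
      set V := Module.End.eigenspace (R i) c with hV
      have hVtop : V < ⊤ := by
        rw [lt_top_iff_ne_top]
        intro h
        obtain ⟨v, hv⟩ := hi c
        exact hv (Module.End.mem_eigenspace_iff.1 (h ▸ Submodule.mem_top : v ∈ V))
      have hinv : ∀ j, ∀ v ∈ V, R j v ∈ V := by
        intro j v hv
        rw [hV, Module.End.mem_eigenspace_iff] at hv ⊢
        rw [hR, hv, map_smul]
      have : Nontrivial V := Submodule.nontrivial_iff_ne_bot.2 hc
      have hlt := Submodule.finrank_lt hVtop.ne
      obtain ⟨v, hv0, hv⟩ := ih (E := V) (by omega) (fun j => (R j).restrict (hinv j))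
        (fun j k v => Subtype.ext (hR j k v))
      refine ⟨v, fun h => hv0 (Subtype.ext h), fun j => ?_⟩
      obtain ⟨d, hd⟩ := hv j
      exact ⟨d, congrArg Subtype.val hd⟩

end JointEigenvector

/-! ### Convolution operators on L² of a compact abelian group -/

section Convolution

variable {K : Type*} [CommGroup K] [TopologicalSpace K] [IsTopologicalGroup K]

/-- The function `y ↦ φ (y * x⁻¹)` as a function of `x` with values in `C(K, ℂ)`. -/
def convKernel (φ : C(K, ℂ)) : C(K, C(K, ℂ)) :=
  ContinuousMap.curry ⟨fun p : K × K => φ (p.2 * p.1⁻¹), by fun_prop⟩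

lemma convKernel_apply (φ : C(K, ℂ)) (x y : K) : convKernel φ x y = φ (y * x⁻¹) := rfl

/-- The translate `x ↦ f (z * x)`. -/
def translate (z : K) : C(K, ℂ) →ₗ[ℂ] C(K, ℂ) where
  toFun f := f.comp ⟨fun x => z * x, by fun_prop⟩
  map_add' _ _ := rfl
  map_smul' _ _ := rfl

lemma translate_apply (z : K) (f : C(K, ℂ)) (x : K) : translate z f x = f (z * x) := rfl

/-- A character as a continuous complex function. -/
def charFun (χ : PontryaginDual K) : C(K, ℂ) :=
  ⟨fun x => (χ x : ℂ), continuous_subtype_val.comp (map_continuous χ)⟩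

lemma charFun_apply (χ : PontryaginDual K) (x : K) : charFun χ x = (χ x : ℂ) := rfl

variable [CompactSpace K] [MeasurableSpace K] [BorelSpace K]
  (μ : Measure K) [IsProbabilityMeasure μ]

/-- The convolution `x ↦ ∫ conj (φ (y * x⁻¹)) f y dμ(y)` of a continuous function with a
square-integrable one. -/
def convFun (φ : C(K, ℂ)) : Lp ℂ 2 μ →ₗ[ℂ] C(K, ℂ) where
  toFun f := ⟨fun x => inner ℂ (ContinuousMap.toLp 2 μ ℂ (convKernel φ x)) f, by fun_prop⟩
  map_add' f g := by ext x; simp [inner_add_right]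
  map_smul' c f := by ext x; simp [inner_smul_right]

lemma convFun_apply (φ : C(K, ℂ)) (f : Lp ℂ 2 μ) (x : K) :
    convFun μ φ f x = inner ℂ (ContinuousMap.toLp 2 μ ℂ (convKernel φ x)) f := rfl

lemma convFun_eq_integral (φ : C(K, ℂ)) (f : Lp ℂ 2 μ) (x : K) :
    convFun μ φ f x = ∫ y, f y * (starRingEnd ℂ) (φ (y * x⁻¹)) ∂μ := by
  rw [convFun_apply, L2.inner_def]
  refine integral_congr_ae ?_
  filter_upwards [ContinuousMap.coeFn_toLp (p := 2) (𝕜 := ℂ) μ (convKernel φ x)] with y hy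
  rw [hy, RCLike.inner_apply, convKernel_apply]

lemma norm_toLp_le (f : C(K, ℂ)) : ‖ContinuousMap.toLp 2 μ ℂ f‖ ≤ ‖f‖ := by
  refine (ContinuousLinearMap.le_opNorm _ _).trans ?_
  refine mul_le_of_le_one_left (norm_nonneg _) ?_
  refine (ContinuousMap.toLp_norm_le (𝕜 := ℂ) (E := ℂ) (p := 2) μ).trans ?_
  simp [measureUnivNNReal]

lemma norm_convKernel_le (φ : C(K, ℂ)) (x : K) : ‖convKernel φ x‖ ≤ ‖φ‖ := by
  rw [ContinuousMap.norm_le _ (norm_nonneg _)]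
  exact fun y => φ.norm_coe_le_norm _

lemma norm_convFun_le (φ : C(K, ℂ)) (f : Lp ℂ 2 μ) : ‖convFun μ φ f‖ ≤ ‖φ‖ * ‖f‖ := by
  rw [ContinuousMap.norm_le _ (by positivity)]
  intro x
  rw [convFun_apply]
  refine (norm_inner_le_norm _ _).trans ?_
  gcongr
  exact (norm_toLp_le μ _).trans (norm_convKernel_le φ x)

/-- Convolution with a continuous function as a bounded operator on `L²`. -/
def convOp (φ : C(K, ℂ)) : Lp ℂ 2 μ →L[ℂ] Lp ℂ 2 μ :=
  (ContinuousMap.toLp 2 μ ℂ).comp ((convFun μ φ).mkContinuous ‖φ‖ (norm_convFun_le μ φ))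

lemma convOp_apply (φ : C(K, ℂ)) (f : Lp ℂ 2 μ) :
    convOp μ φ f = ContinuousMap.toLp 2 μ ℂ (convFun μ φ f) := rfl

/-- Arzelà–Ascoli: by Cauchy–Schwarz the image of the unit ball is bounded by ‖φ‖ in the sup norm,
and its modulus of continuity at x₀ is controlled by ‖`convKernel φ x₀` - `convKernel φ x`‖,
uniformly over the ball. The inclusion of continuous functions in L² preserves compactness. -/
lemma isCompactOperator_convOp (φ : C(K, ℂ)) : IsCompactOperator (convOp μ φ) := by
  rw [isCompactOperator_iff_exists_mem_nhds_image_subset_compact]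
  set S : Set (BoundedContinuousFunction K ℂ) :=
    (fun f => BoundedContinuousFunction.mkOfCompact (convFun μ φ f)) '' Metric.closedBall 0 1
    with hS
  have hc : IsCompact (closure S) := by
    refine BoundedContinuousFunction.arzela_ascoli (Metric.closedBall (0 : ℂ) ‖φ‖)
      (isCompact_closedBall _ _) S ?_ ?_
    · rintro _ x ⟨f, hf, rfl⟩
      rw [mem_closedBall_zero_iff] at hf ⊢
      refine ((convFun μ φ f).norm_coe_le_norm x).trans ((norm_convFun_le μ φ f).trans ?_)
      exact mul_le_of_le_one_right (norm_nonneg _) hf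
    · intro x₀
      refine Metric.equicontinuousAt_of_continuity_modulus
        (fun x => ‖convKernel φ x₀ - convKernel φ x‖) ?_ _ (Filter.Eventually.of_forall ?_)
      · have : Continuous fun x => ‖convKernel φ x₀ - convKernel φ x‖ := by fun_prop
        simpa using this.tendsto x₀
      · rintro x ⟨_, f, hf, rfl⟩
        rw [mem_closedBall_zero_iff] at hf
        change dist (convFun μ φ f x₀) (convFun μ φ f x) ≤ _
        rw [dist_eq_norm, convFun_apply, convFun_apply, ← inner_sub_left, ← map_sub]
        refine (norm_inner_le_norm _ _).trans ?_
        exact (mul_le_of_le_one_right (norm_nonneg _) hf).trans (norm_toLp_le μ _)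
  refine ⟨Metric.closedBall 0 1, Metric.closedBall_mem_nhds _ one_pos, _,
    hc.image (BoundedContinuousFunction.toLp (E := ℂ) 2 μ ℂ).continuous, ?_⟩
  rintro _ ⟨f, hf, rfl⟩
  exact ⟨_, subset_closure ⟨f, hf, rfl⟩, rfl⟩

lemma inner_toLp_left (g : C(K, ℂ)) (f : Lp ℂ 2 μ) :
    inner ℂ (ContinuousMap.toLp 2 μ ℂ g) f = ∫ x, f x * (starRingEnd ℂ) (g x) ∂μ := by
  rw [L2.inner_def]
  refine integral_congr_ae ?_
  filter_upwards [ContinuousMap.coeFn_toLp (p := 2) (𝕜 := ℂ) μ g] with y hy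
  rw [hy, RCLike.inner_apply]

lemma inner_toLp_right (g : C(K, ℂ)) (f : Lp ℂ 2 μ) :
    inner ℂ f (ContinuousMap.toLp 2 μ ℂ g) = ∫ x, g x * (starRingEnd ℂ) (f x) ∂μ := by
  rw [L2.inner_def]
  refine integral_congr_ae ?_
  filter_upwards [ContinuousMap.coeFn_toLp (p := 2) (𝕜 := ℂ) μ g] with y hy
  rw [hy, RCLike.inner_apply]

variable [SecondCountableTopology K]

lemma integrable_coeFn_L2 (f : Lp ℂ 2 μ) : Integrable f μ :=
  (Lp.memLp f).integrable (by norm_num)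

/-- The condition on φ makes the kernel φ(y x⁻¹) Hermitian; the rest is Fubini. -/
lemma isSymmetric_convOp (φ : C(K, ℂ)) (hφ : ∀ x, φ x⁻¹ = (starRingEnd ℂ) (φ x)) :
    (convOp μ φ : Lp ℂ 2 μ →ₗ[ℂ] Lp ℂ 2 μ).IsSymmetric := by
  intro f g
  change inner ℂ (convOp μ φ f) g = inner ℂ f (convOp μ φ g)
  rw [convOp_apply, convOp_apply, inner_toLp_left, inner_toLp_right]
  simp_rw [convFun_eq_integral, ← integral_conj, ← integral_const_mul, ← integral_mul_const]
  rw [integral_integral_swap]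
  · congr 1 with y
    congr 1 with x
    have : (starRingEnd ℂ) (φ (x * y⁻¹)) = φ (y * x⁻¹) := by
      rw [← hφ, mul_inv_rev, inv_inv]
    rw [this]
    simp
    ring
  · have h1 : Integrable (fun p : K × K => g p.1 * (starRingEnd ℂ) (f p.2)) (μ.prod μ) :=
      (integrable_coeFn_L2 μ g).mul_prod
        ((Complex.conjLIE.toContinuousLinearEquiv.toContinuousLinearMap).integrable_comp
          (integrable_coeFn_L2 μ f))
    have h2 : Integrable (fun p : K × K => φ (p.2 * p.1⁻¹) * (g p.1 * (starRingEnd ℂ) (f p.2)))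
        (μ.prod μ) := by
      refine h1.bdd_mul (c := ‖φ‖) ?_ (Filter.Eventually.of_forall fun p => φ.norm_coe_le_norm _)
      exact Continuous.aestronglyMeasurable (by fun_prop)
    refine h2.congr (Filter.Eventually.of_forall fun p => ?_)
    simp [Function.uncurry]
    ring

end Convolution

/-! ### Characters and the spectral argument for Peter–Weyl -/

section PeterWeyl

variable {K : Type*} [CommGroup K] [TopologicalSpace K] [IsTopologicalGroup K] [CompactSpace K]
  [MeasurableSpace K] [BorelSpace K]
  (μ : Measure K) [IsProbabilityMeasure μ] [μ.IsMulLeftInvariant]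

lemma convFun_toLp (φ v : C(K, ℂ)) (x : K) :
    convFun μ φ (ContinuousMap.toLp 2 μ ℂ v) x =
      ∫ y, v (y * x) * (starRingEnd ℂ) (φ y) ∂μ := by
  have h : convFun μ φ (ContinuousMap.toLp 2 μ ℂ v) x =
      ∫ y, v y * (starRingEnd ℂ) (φ (y * x⁻¹)) ∂μ := by
    rw [convFun_eq_integral]
    refine integral_congr_ae ?_
    filter_upwards [ContinuousMap.coeFn_toLp (p := 2) (𝕜 := ℂ) μ v] with y hy
    rw [hy]
  rw [h, ← integral_mul_right_eq_self _ x]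
  simp only [mul_inv_cancel_right]

lemma convFun_translate (φ v : C(K, ℂ)) (z : K) :
    convFun μ φ (ContinuousMap.toLp 2 μ ℂ (translate z v)) =
      translate z (convFun μ φ (ContinuousMap.toLp 2 μ ℂ v)) := by
  ext x
  simp only [translate_apply, convFun_toLp]
  refine integral_congr_ae (Filter.Eventually.of_forall fun y => ?_)
  simp only [mul_left_comm]

lemma charFun_mul (χ : PontryaginDual K) (x y : K) :
    charFun χ (x * y) = charFun χ x * charFun χ y := by
  simp [charFun_apply]

lemma charFun_mul_conj (χ : PontryaginDual K) (x : K) :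
    charFun χ x * (starRingEnd ℂ) (charFun χ x) = 1 := by
  rw [charFun_apply, Complex.mul_conj, Circle.normSq_coe]
  simp

lemma convFun_charFun (φ : C(K, ℂ)) (χ : PontryaginDual K) :
    convFun μ φ (ContinuousMap.toLp 2 μ ℂ (charFun χ)) =
      (∫ y, charFun χ y * (starRingEnd ℂ) (φ y) ∂μ) • charFun χ := by
  ext x
  rw [convFun_toLp, ContinuousMap.smul_apply, smul_eq_mul, ← integral_mul_const]
  refine integral_congr_ae (Filter.Eventually.of_forall fun y => ?_)
  simp only [charFun_mul]
  ring

lemma inner_charFun_translate (χ : PontryaginDual K) (v : C(K, ℂ)) (z : K) :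
    inner ℂ (ContinuousMap.toLp 2 μ ℂ (charFun χ)) (ContinuousMap.toLp 2 μ ℂ (translate z v)) =
      charFun χ z *
        inner ℂ (ContinuousMap.toLp 2 μ ℂ (charFun χ)) (ContinuousMap.toLp 2 μ ℂ v) := by
  rw [ContinuousMap.inner_toLp, ContinuousMap.inner_toLp,
    ← integral_mul_left_eq_self (fun x => v x * (starRingEnd ℂ) (charFun χ x)) z,
    ← integral_const_mul]
  refine integral_congr_ae (Filter.Eventually.of_forall fun x => ?_)
  simp only [translate_apply, charFun_mul, map_mul]
  linear_combination (-v (z * x) * (starRingEnd ℂ) (charFun χ x)) * charFun_mul_conj χ z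

lemma orthonormal_charFun :
    Orthonormal ℂ fun χ : PontryaginDual K => ContinuousMap.toLp 2 μ ℂ (charFun χ) := by
  classical
  rw [orthonormal_iff_ite]
  intro χ ψ
  split_ifs with h
  · subst h
    rw [ContinuousMap.inner_toLp]
    simp [charFun_mul_conj]
  · obtain ⟨z, hz⟩ : ∃ z, χ z ≠ ψ z := by
      by_contra! h'
      exact h (PontryaginDual.ext h')
    have h1 := inner_charFun_translate μ χ (charFun ψ) z
    have h2 : translate z (charFun ψ) = charFun ψ z • charFun ψ := by
      ext x
      simp [translate_apply, charFun_mul]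
    rw [h2, map_smul, inner_smul_right] at h1
    by_contra h0
    refine hz (Circle.ext ?_)
    exact (mul_right_cancel₀ h0 h1).symm

/-- The span of the characters in `L²`. -/
def charSpan : Submodule ℂ (Lp ℂ 2 μ) :=
  Submodule.span ℂ (Set.range fun χ : PontryaginDual K => ContinuousMap.toLp 2 μ ℂ (charFun χ))

lemma mem_charSpan_orthogonal (f : Lp ℂ 2 μ) :
    f ∈ (charSpan μ)ᗮ ↔
      ∀ χ : PontryaginDual K, inner ℂ (ContinuousMap.toLp 2 μ ℂ (charFun χ)) f = 0 := by
  constructor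
  · intro h χ
    exact h _ (Submodule.subset_span ⟨χ, rfl⟩)
  · intro h
    rw [Submodule.mem_orthogonal]
    intro u hu
    induction hu using Submodule.span_induction with
    | mem u hu => obtain ⟨χ, rfl⟩ := hu; exact h χ
    | zero => exact inner_zero_left _
    | add u w _ _ hu hw => rw [inner_add_left, hu, hw, add_zero]
    | smul a u _ hu => rw [inner_smul_left, hu, mul_zero]

/-- A continuous function all of whose translates are multiples of it is a multiple of a
character. -/
lemma exists_eq_smul_charFun (v : C(K, ℂ)) (hv : v ≠ 0)
    (h : ∀ z, ∃ c : ℂ, translate z v = c • v) :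
    ∃ (χ : PontryaginDual K) (a : ℂ), a ≠ 0 ∧ v = a • charFun χ := by
  choose c hc using h
  have hc' : ∀ z x, v (z * x) = c z * v x := fun z x => congrArg (fun f : C(K, ℂ) => f x) (hc z)
  have hv1 : v 1 ≠ 0 := by
    intro h0
    refine hv (ContinuousMap.ext fun z => ?_)
    simpa [h0] using hc' z 1
  have hcv : ∀ z, c z = v z / v 1 := fun z => by
    rw [eq_div_iff hv1, ← hc', mul_one]
  have hmul : ∀ z w, c (z * w) = c z * c w := fun z w => by
    rw [hcv (z * w), hc', hcv w]
    ring
  have hone : c 1 = 1 := by rw [hcv, div_self hv1]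
  -- Evaluating at a maximum of |v| gives |c| ≤ 1; applied to both z and z⁻¹, this forces |c| = 1.
  obtain ⟨x₀, -, hx₀⟩ := isCompact_univ.exists_isMaxOn (Set.univ_nonempty (α := K))
    (f := fun x => ‖v x‖) (by fun_prop)
  have hpos : 0 < ‖v x₀‖ := (norm_pos_iff.2 hv1).trans_le (hx₀ (Set.mem_univ 1))
  have hle : ∀ z, ‖c z‖ ≤ 1 := fun z => by
    have : ‖v (z * x₀)‖ ≤ ‖v x₀‖ := hx₀ (Set.mem_univ _)
    rw [hc', norm_mul] at this
    exact (mul_le_iff_le_one_left hpos).1 this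
  have hnorm : ∀ z, ‖c z‖ = 1 := fun z => by
    refine le_antisymm (hle z) ?_
    have h1 : ‖c z‖ * ‖c z⁻¹‖ = 1 := by
      rw [← norm_mul, ← hmul, mul_inv_cancel, hone, norm_one]
    nlinarith [hle z⁻¹, norm_nonneg (c z)]
  have hcont : Continuous c := by
    have : c = fun z => v z / v 1 := funext hcv
    rw [this]
    fun_prop
  let χ : PontryaginDual K :=
    { toFun := fun z => ⟨c z, mem_sphere_zero_iff_norm.2 (hnorm z)⟩
      map_one' := Subtype.ext hone
      map_mul' := fun z w => Subtype.ext (hmul z w)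
      continuous_toFun := hcont.subtype_mk _ }
  refine ⟨χ, v 1, hv1, ContinuousMap.ext fun x => ?_⟩
  change v x = v 1 * c x
  rw [hcv]
  field_simp

variable [SecondCountableTopology K] [T2Space K] [μ.IsOpenPosMeasure]

/-- Characters are eigenvectors of a symmetric operator, so it preserves their orthogonal
complement. -/
lemma convOp_mem_orthogonal (φ : C(K, ℂ)) (hφ : ∀ x, φ x⁻¹ = (starRingEnd ℂ) (φ x)) :
    ∀ f ∈ (charSpan μ)ᗮ, convOp μ φ f ∈ (charSpan μ)ᗮ := by
  intro f hf
  rw [mem_charSpan_orthogonal] at hf ⊢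
  intro χ
  have := isSymmetric_convOp μ φ hφ (ContinuousMap.toLp 2 μ ℂ (charFun χ)) f
  rw [ContinuousLinearMap.coe_coe] at this
  rw [← this, convOp_apply, convFun_charFun, map_smul, inner_smul_left, hf, mul_zero]

/-- A compact symmetric operator without nonzero eigenvalues vanishes. An eigenspace for c ≠ 0
inside the complement is finite-dimensional and translation invariant, so it contains a joint
eigenvector of the translations, that is, a multiple of a character, which would be orthogonal to
itself. -/
lemma convOp_eq_zero_of_mem_orthogonal (φ : C(K, ℂ)) (hφ : ∀ x, φ x⁻¹ = (starRingEnd ℂ) (φ x))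
    (f : Lp ℂ 2 μ) (hf : f ∈ (charSpan μ)ᗮ) : convOp μ φ f = 0 := by
  have hinv := convOp_mem_orthogonal μ φ hφ
  let S : (charSpan μ)ᗮ →L[ℂ] (charSpan μ)ᗮ := (convOp μ φ).restrict hinv
  have hSc : IsCompactOperator S := (isCompactOperator_convOp μ φ).restrict' hinv
  have hSs : (S : (charSpan μ)ᗮ →ₗ[ℂ] (charSpan μ)ᗮ).IsSymmetric :=
    (isSymmetric_convOp μ φ hφ).restrict_invariant hinv
  suffices h : S = 0 from congrArg Subtype.val (congrArg (fun T => T ⟨f, hf⟩) h)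
  rw [← ContinuousLinearMap.eq_zero_of_forall_hasEigenvalue_eq_zero hSc hSs]
  intro c hc
  by_contra hc0
  -- The eigenspace is modelled by continuous functions, where translates and values at points make
  -- sense.
  let E : Submodule ℂ C(K, ℂ) :=
    { carrier := {v | convFun μ φ (ContinuousMap.toLp 2 μ ℂ v) = c • v ∧
        ContinuousMap.toLp 2 μ ℂ v ∈ (charSpan μ)ᗮ}
      add_mem' := fun {v w} hv hw =>
        ⟨by rw [map_add, map_add, hv.1, hw.1, smul_add],
          by rw [map_add]; exact Submodule.add_mem _ hv.2 hw.2⟩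
      zero_mem' := ⟨by simp, by simp⟩
      smul_mem' := fun a v hv =>
        ⟨by rw [map_smul, map_smul, hv.1, smul_comm],
          by rw [map_smul]; exact Submodule.smul_mem _ _ hv.2⟩ }
  have hfin := ContinuousLinearMap.finite_dimensional_eigenspace hSc c hc0
  let ι : E →ₗ[ℂ] Module.End.eigenspace (S : (charSpan μ)ᗮ →ₗ[ℂ] (charSpan μ)ᗮ) c :=
    { toFun := fun v => ⟨⟨ContinuousMap.toLp 2 μ ℂ v.1, v.2.2⟩, by
        rw [Module.End.mem_eigenspace_iff]
        refine Subtype.ext ?_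
        change convOp μ φ (ContinuousMap.toLp 2 μ ℂ v.1) = c • ContinuousMap.toLp 2 μ ℂ v.1
        rw [convOp_apply, v.2.1, map_smul]⟩
      map_add' := fun v w => by ext1; ext1; simp
      map_smul' := fun a v => by ext1; ext1; simp }
  have hι : Function.Injective ι := by
    intro v w h
    have h' := congrArg Subtype.val (congrArg Subtype.val h)
    exact Subtype.ext (ContinuousMap.toLp_injective μ h')
  have : FiniteDimensional ℂ E := FiniteDimensional.of_injective ι hι
  have : Nontrivial E := by
    obtain ⟨⟨g, hg⟩, hgc, hg0⟩ := hc.exists_hasEigenvector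
    rw [Module.End.mem_eigenspace_iff] at hgc
    have hgc' : convOp μ φ g = c • g := congrArg Subtype.val hgc
    -- Convolution has continuous values, so an eigenvector with c ≠ 0 has a continuous
    -- representative.
    have hlp : ContinuousMap.toLp 2 μ ℂ (c⁻¹ • convFun μ φ g) = g := by
      rw [map_smul, ← convOp_apply, hgc', smul_smul, inv_mul_cancel₀ hc0, one_smul]
    refine ⟨⟨⟨c⁻¹ • convFun μ φ g, ?_, ?_⟩, 0, ?_⟩⟩
    · rw [hlp, smul_smul, mul_inv_cancel₀ hc0, one_smul]
    · rw [hlp]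
      exact hg
    · intro h
      have h' := congrArg Subtype.val h
      change c⁻¹ • convFun μ φ g = 0 at h'
      rw [h', map_zero] at hlp
      exact hg0 (Subtype.ext hlp.symm)
  have htr : ∀ z, ∀ v ∈ E, translate z v ∈ E := by
    rintro z v ⟨hv1, hv2⟩
    refine ⟨by rw [convFun_translate, hv1, map_smul], ?_⟩
    rw [mem_charSpan_orthogonal] at hv2 ⊢
    intro χ
    rw [inner_charFun_translate, hv2, mul_zero]
  obtain ⟨⟨v, hvE⟩, hv0, hv⟩ := exists_joint_eigenvector (Module.finrank ℂ E) le_rfl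
    (fun z : K => (translate z).restrict (htr z)) (fun z w v => by
      refine Subtype.ext (ContinuousMap.ext fun x => ?_)
      change v.1 (w * (z * x)) = v.1 (z * (w * x))
      rw [mul_left_comm])
  obtain ⟨χ, a, ha, rfl⟩ := exists_eq_smul_charFun v (fun h => hv0 (Subtype.ext h)) (fun z => by
    obtain ⟨d, hd⟩ := hv z
    exact ⟨d, congrArg Subtype.val hd⟩)
  have h1 := (mem_charSpan_orthogonal μ _).1 hvE.2 χ
  rw [map_smul, inner_smul_right, inner_self_eq_norm_sq_to_K,
    (orthonormal_charFun μ).1 χ] at h1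
  simp [ha] at h1

end PeterWeyl

/-! ### Bump functions near the identity -/

section Bump

/-- Symmetric bump functions of integral one supported near the identity. -/
lemma exists_bump {G : Type*} [CommGroup G] [TopologicalSpace G] [IsTopologicalGroup G]
    [T2Space G] [LocallyCompactSpace G] [MeasurableSpace G] [BorelSpace G] (μ : Measure G)
    [IsFiniteMeasureOnCompacts μ] [μ.IsOpenPosMeasure] {N : Set G} (hN : N ∈ nhds (1 : G)) :
    ∃ ρ : G → ℝ, Continuous ρ ∧ HasCompactSupport ρ ∧ (∀ x, 0 ≤ ρ x) ∧ (∀ x, ρ x⁻¹ = ρ x) ∧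
      (∀ x, x ∉ N → ρ x = 0) ∧ ∫ x, ρ x ∂μ = 1 := by
  obtain ⟨f, hf1, hf0, hfc, hf⟩ := exists_continuous_one_zero_of_isCompact
    (isCompact_singleton (x := (1 : G))) (isOpen_interior (s := N)).isClosed_compl
    (Set.disjoint_left.2 fun x hx hx' => hx' (by
      rw [Set.mem_singleton_iff.1 hx]; exact mem_interior_iff_mem_nhds.2 hN))
  have hcont : Continuous fun x => f x * f x⁻¹ := by fun_prop
  have hsupp : HasCompactSupport fun x => f x * f x⁻¹ := hfc.mul_right
  have hnn : ∀ x, 0 ≤ f x * f x⁻¹ := fun x => mul_nonneg (hf x).1 (hf _).1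
  have hpos : 0 < ∫ x, f x * f x⁻¹ ∂μ := by
    refine hcont.integral_pos_of_hasCompactSupport_nonneg_nonzero hsupp hnn (x := 1) ?_
    rw [inv_one, hf1 rfl]
    simp
  set I := ∫ x, f x * f x⁻¹ ∂μ
  refine ⟨fun x => I⁻¹ * (f x * f x⁻¹), by fun_prop, hsupp.mul_left,
    fun x => mul_nonneg (inv_nonneg.2 hpos.le) (hnn x), fun x => ?_, fun x hx => ?_, ?_⟩
  · simp only [inv_inv, mul_comm (f x⁻¹)]
  · simp [hf0 (fun h => hx (interior_subset h) : x ∈ (interior N)ᶜ)]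
  · rw [integral_const_mul, inv_mul_cancel₀ hpos.ne']

end Bump

/-! ### Completeness of the characters and Parseval's identity -/

section Parseval

variable {K : Type*} [CommGroup K] [TopologicalSpace K] [IsTopologicalGroup K] [CompactSpace K]
  [T2Space K] [SecondCountableTopology K] [MeasurableSpace K] [BorelSpace K]
  (μ : Measure K) [IsProbabilityMeasure μ] [μ.IsMulLeftInvariant] [μ.IsOpenPosMeasure]

/-- Approximate identity: φ is a symmetric bump supported where translation moves g by less than ε
in the sup norm. -/
lemma exists_norm_convFun_sub_le (g : C(K, ℂ)) {ε : ℝ} (hε : 0 < ε) :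
    ∃ φ : C(K, ℂ), (∀ x, φ x⁻¹ = (starRingEnd ℂ) (φ x)) ∧
      ‖convFun μ φ (ContinuousMap.toLp 2 μ ℂ g) - g‖ ≤ ε := by
  have hcont : Continuous fun y => translate y g :=
    (ContinuousMap.curry ⟨fun p : K × K => g (p.1 * p.2), by fun_prop⟩).continuous
  have hN : {y | ‖translate y g - g‖ < ε} ∈ nhds (1 : K) := by
    refine (isOpen_lt (by fun_prop) continuous_const).mem_nhds ?_
    have : translate 1 g = g := ContinuousMap.ext fun x => by rw [translate_apply, one_mul]
    simpa [this] using hε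
  obtain ⟨ρ, hρ, -, hnn, hsymm, hsupp, hint⟩ := exists_bump μ hN
  have hρi : Integrable ρ μ :=
    hρ.integrable_of_hasCompactSupport (HasCompactSupport.of_compactSpace ρ)
  refine ⟨⟨fun x => (ρ x : ℂ), by fun_prop⟩, fun x => by simp [hsymm], ?_⟩
  rw [ContinuousMap.norm_le _ hε.le]
  intro x
  rw [ContinuousMap.sub_apply, convFun_toLp]
  have h1 : g x = ∫ y, g x * (ρ y : ℂ) ∂μ := by
    rw [integral_const_mul, integral_complex_ofReal, hint]
    simp
  rw [h1, ← integral_sub]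
  · calc _ ≤ ∫ y, ε * ρ y ∂μ := by
          refine norm_integral_le_of_norm_le (hρi.const_mul ε)
            (Filter.Eventually.of_forall fun y => ?_)
          simp only [ContinuousMap.coe_mk, Complex.conj_ofReal]
          rw [← sub_mul, norm_mul, Complex.norm_real, Real.norm_of_nonneg (hnn y)]
          by_cases hy : y ∈ {y | ‖translate y g - g‖ < ε}
          · refine mul_le_mul_of_nonneg_right ?_ (hnn y)
            exact ((translate y g - g).norm_coe_le_norm x).trans (le_of_lt hy)
          · rw [hsupp y hy]
            simp
      _ = ε := by rw [integral_const_mul, hint, mul_one]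
  · exact Continuous.integrable_of_hasCompactSupport (by
      have : Continuous fun y => g (y * x) := by fun_prop
      exact this.mul (by fun_prop))
      (HasCompactSupport.of_compactSpace _)
  · exact Continuous.integrable_of_hasCompactSupport (by fun_prop)
      (HasCompactSupport.of_compactSpace _)

/-- **Peter–Weyl** for compact abelian groups: the characters span a dense subspace of `L²`. -/
theorem charSpan_orthogonal : (charSpan μ)ᗮ = ⊥ := by
  rw [Submodule.eq_bot_iff]
  intro f hf
  have h0 : ∀ g : C(K, ℂ), inner ℂ (ContinuousMap.toLp 2 μ ℂ g) f = 0 := by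
    intro g
    rw [← norm_le_zero_iff]
    refine le_of_forall_pos_le_add fun ε hε => ?_
    have hε' : 0 < ε / (‖f‖ + 1) := by positivity
    obtain ⟨φ, hφ, hle⟩ := exists_norm_convFun_sub_le μ g hε'
    -- By symmetry the operator can be moved onto f, which it annihilates; only the small
    -- approximation error of g remains.
    have h1 : inner ℂ (convOp μ φ (ContinuousMap.toLp 2 μ ℂ g)) f = 0 := by
      have := isSymmetric_convOp μ φ hφ (ContinuousMap.toLp 2 μ ℂ g) f
      rw [ContinuousLinearMap.coe_coe] at this
      rw [this, convOp_eq_zero_of_mem_orthogonal μ φ hφ f hf, inner_zero_right]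
    rw [convOp_apply] at h1
    have h2 : inner ℂ (ContinuousMap.toLp 2 μ ℂ g) f = - inner ℂ (ContinuousMap.toLp 2 μ ℂ
        (convFun μ φ (ContinuousMap.toLp 2 μ ℂ g) - g)) f := by
      rw [map_sub, inner_sub_left, h1]
      simp
    rw [h2, norm_neg, zero_add]
    refine (norm_inner_le_norm _ _).trans ?_
    calc _ ≤ ε / (‖f‖ + 1) * (‖f‖ + 1) := by
          gcongr
          · exact (norm_toLp_le μ _).trans hle
          · linarith
      _ = ε := by field_simp
  refine (ContinuousMap.toLp_denseRange ℂ μ ℂ (p := 2) (by norm_num)).induction_on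
    (p := fun u => inner ℂ u f = 0) f ?_ h0 |> inner_self_eq_zero.1
  exact isClosed_eq (by fun_prop) continuous_const

/-- **Parseval's identity** on a compact abelian group. -/
theorem hasSum_norm_sq_integral_char (f : K → ℂ) (hf : MemLp f 2 μ) :
    HasSum (fun χ : PontryaginDual K => ‖∫ x, f x * (starRingEnd ℂ) (χ x : ℂ) ∂μ‖ ^ 2)
      (∫ x, ‖f x‖ ^ 2 ∂μ) := by
  let b := HilbertBasis.mkOfOrthogonalEqBot (orthonormal_charFun μ) (charSpan_orthogonal μ)
  have hb : ∀ χ, b χ = ContinuousMap.toLp 2 μ ℂ (charFun χ) := fun χ =>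
    congrFun (HilbertBasis.coe_mkOfOrthogonalEqBot (orthonormal_charFun μ) _) χ
  have h := b.hasSum_inner_mul_inner hf.toLp hf.toLp
  have hin : ∀ χ, inner ℂ (b χ) (hf.toLp f) = ∫ x, f x * (starRingEnd ℂ) (χ x : ℂ) ∂μ := by
    intro χ
    rw [hb, inner_toLp_left]
    refine integral_congr_ae ?_
    filter_upwards [hf.coeFn_toLp] with x hx
    rw [hx, charFun_apply]
  have hself : inner ℂ (hf.toLp f) (hf.toLp f) = ((∫ x, ‖f x‖ ^ 2 ∂μ : ℝ) : ℂ) := by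
    rw [L2.inner_def, ← integral_complex_ofReal]
    refine integral_congr_ae ?_
    filter_upwards [hf.coeFn_toLp] with x hx
    rw [hx, inner_self_eq_norm_sq_to_K]
    simp
  rw [hself] at h
  have h' := Complex.hasSum_re h
  rw [Complex.ofReal_re] at h'
  convert h' using 2 with χ
  rw [← inner_conj_symm, hin, ← Complex.normSq_eq_conj_mul_self, Complex.ofReal_re,
    Complex.normSq_eq_norm_sq]

end Parseval

/-! ### Polishness and second countability -/

section Polish

/-- A locally compact second countable Hausdorff abelian group is Polish. -/
lemma polishSpace_of_locallyCompact_group (G : Type*) [CommGroup G] [TopologicalSpace G]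
    [IsTopologicalGroup G] [T2Space G] [LocallyCompactSpace G] [SecondCountableTopology G] :
    PolishSpace G := by
  let _ : UniformSpace G := IsTopologicalGroup.rightUniformSpace G
  have : IsUniformGroup G := isUniformGroup_of_commGroup
  have : CompleteSpace G := IsRightUniformGroup.completeSpace_of_weaklyLocallyCompactSpace
  have : (uniformity G).IsCountablyGenerated := by
    rw [uniformity_eq_comap_nhds_one]
    infer_instance
  have : TopologicalSpace.MetrizableSpace G := UniformSpace.metrizableSpace
  infer_instance

instance secondCountableTopology_pontryaginDual (G : Type*) [CommGroup G] [TopologicalSpace G]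
    [IsTopologicalGroup G] [LocallyCompactSpace G] [SecondCountableTopology G] :
    SecondCountableTopology (PontryaginDual G) :=
  (ContinuousMonoidHom.isInducing_toContinuousMap G Circle).secondCountableTopology

end Polish

/-! ### Uniqueness of Fourier transforms of measures -/

section Dual

variable {G : Type*} [CommGroup G] [TopologicalSpace G] [IsTopologicalGroup G] [T2Space G]
  [LocallyCompactSpace G] [SecondCountableTopology G] [MeasurableSpace G] [BorelSpace G]

lemma continuous_pontryaginDual_eval :
    Continuous fun p : PontryaginDual G × G => p.1 p.2 := by
  have h : Continuous fun p : C(G, Circle) × G => p.1 p.2 := continuous_eval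
  exact h.comp (((ContinuousMonoidHom.isInducing_toContinuousMap G Circle).continuous.comp
    continuous_fst).prodMk continuous_snd)

lemma continuous_pontryaginDual_eval_right (x : G) :
    Continuous fun χ : PontryaginDual G => (χ x : ℂ) :=
  continuous_subtype_val.comp
    (continuous_pontryaginDual_eval.comp (continuous_id.prodMk continuous_const))

lemma continuous_pontryaginDual_apply (χ : PontryaginDual G) : Continuous fun x => (χ x : ℂ) :=
  continuous_subtype_val.comp (map_continuous χ)

/-- Evaluation at a point of `G` as a bounded continuous function on the dual. -/
def evalBCF : G →* BoundedContinuousFunction (PontryaginDual G) ℂ where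
  toFun x := BoundedContinuousFunction.ofNormedAddCommGroup (fun χ => (χ x : ℂ))
    (continuous_pontryaginDual_eval_right x) 1 (fun χ => (Circle.norm_coe _).le)
  map_one' := by ext χ; simp
  map_mul' x y := by ext χ; simp

lemma star_range_evalBCF : star (Set.range (evalBCF (G := G))) = Set.range evalBCF := by
  have h : ∀ x : G, star (evalBCF x) = evalBCF x⁻¹ := fun x => by
    ext χ
    change (starRingEnd ℂ) (χ x : ℂ) = (χ x⁻¹ : ℂ)
    rw [map_inv, Circle.coe_inv_eq_conj]
  ext f
  rw [Set.mem_star]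
  constructor
  · rintro ⟨x, hx⟩
    exact ⟨x⁻¹, by rw [← h, hx, star_star]⟩
  · rintro ⟨x, rfl⟩
    exact ⟨x⁻¹, (h x).symm⟩

variable (mG : Measure G) [mG.IsHaarMeasure]

lemma integrable_mul_conj_char {f : G → ℂ} (hf : Integrable f mG) (χ : PontryaginDual G) :
    Integrable (fun x => f x * (starRingEnd ℂ) (χ x : ℂ)) mG := by
  refine hf.mono (hf.1.mul ?_) (Filter.Eventually.of_forall fun x => by simp [Circle.norm_coe (χ x)])
  exact (Complex.continuous_conj.comp (continuous_pontryaginDual_apply χ)).aestronglyMeasurable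

lemma continuous_fourier {f : G → ℂ} (hf : Integrable f mG) : Continuous (fourier mG f) := by
  refine continuous_of_dominated (bound := fun x => ‖f x‖)
    (fun χ => (integrable_mul_conj_char mG hf χ).1)
    (fun χ => Filter.Eventually.of_forall fun x => by simp [Circle.norm_coe (χ x)]) hf.norm
    (Filter.Eventually.of_forall fun x => ?_)
  exact continuous_const.mul (Complex.continuous_conj.comp (continuous_pontryaginDual_eval_right x))

/-- For every compact set of characters there is a function in `C_c(G)` whose Fourier transform
is bounded away from zero on it. -/
lemma exists_half_le_norm_fourier {K : Set (PontryaginDual G)} (hK : IsCompact K) :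
    ∃ f : G → ℂ, Continuous f ∧ HasCompactSupport f ∧
      ∀ χ ∈ K, 1 / 2 ≤ ‖fourier mG f χ‖ := by
  -- Compactness of K gives one neighbourhood of the identity on which all its characters are close
  -- to 1; a bump of integral one supported there has transform within 1/2 of 1 on K.
  have hN : {x : G | ∀ χ ∈ K, ‖(starRingEnd ℂ) (χ x : ℂ) - 1‖ < 1 / 2} ∈ nhds (1 : G) := by
    refine hK.eventually_forall_of_forall_eventually
      (P := fun x χ => ‖(starRingEnd ℂ) (χ x : ℂ) - 1‖ < 1 / 2) fun χ _ => ?_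
    have hc : Continuous fun p : G × PontryaginDual G =>
        ‖(starRingEnd ℂ) (p.2 p.1 : ℂ) - 1‖ :=
      ((Complex.continuous_conj.comp (continuous_subtype_val.comp
        (continuous_pontryaginDual_eval.comp continuous_swap))).sub continuous_const).norm
    refine (isOpen_lt hc continuous_const).mem_nhds ?_
    simp
  obtain ⟨ρ, hρ, hρc, hnn, -, hsupp, hint⟩ := exists_bump mG hN
  have hc : Continuous fun x => (ρ x : ℂ) := by fun_prop
  have hs : HasCompactSupport fun x => (ρ x : ℂ) := hρc.comp_left (g := Complex.ofReal) (by simp)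
  have hi := hc.integrable_of_hasCompactSupport hs (μ := mG)
  have hρi := hρ.integrable_of_hasCompactSupport hρc (μ := mG)
  refine ⟨_, hc, hs, fun χ hχ => ?_⟩
  have h1 : ‖fourier mG (fun x => (ρ x : ℂ)) χ - 1‖ ≤ 1 / 2 := by
    have : (1 : ℂ) = ∫ x, (ρ x : ℂ) ∂mG := by
      rw [integral_complex_ofReal, hint]
      simp
    rw [this, fourier, ← integral_sub (integrable_mul_conj_char mG hi χ) hi]
    calc _ ≤ ∫ x, 1 / 2 * ρ x ∂mG := by
          refine norm_integral_le_of_norm_le (hρi.const_mul _)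
            (Filter.Eventually.of_forall fun x => ?_)
          have : (ρ x : ℂ) * (starRingEnd ℂ) (χ x : ℂ) - ρ x =
            ((starRingEnd ℂ) (χ x : ℂ) - 1) * ρ x := by ring
          rw [this, norm_mul, Complex.norm_real, Real.norm_of_nonneg (hnn x)]
          by_cases hx : x ∈ {x : G | ∀ χ ∈ K, ‖(starRingEnd ℂ) (χ x : ℂ) - 1‖ < 1 / 2}
          · exact mul_le_mul_of_nonneg_right (hx χ hχ).le (hnn x)
          · rw [hsupp x hx]
            simp
      _ = 1 / 2 := by rw [integral_const_mul, hint, mul_one]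
  have h2 := norm_sub_norm_le (1 : ℂ) (1 - fourier mG (fun x => (ρ x : ℂ)) χ)
  rw [norm_sub_rev] at h1
  rw [sub_sub_cancel, norm_one] at h2
  linarith

lemma fourier_add_smul_translate {f : G → ℂ} (hf : Integrable f mG) (u : ℂ) (x : G)
    (χ : PontryaginDual G) :
    fourier mG (fun y => f y + u * f (x⁻¹ * y)) χ =
      (1 + u * (starRingEnd ℂ) (χ x : ℂ)) * fourier mG f χ := by
  have hg : Integrable (fun y => f (x⁻¹ * y)) mG := hf.comp_mul_left x⁻¹
  have h1 : ∫ y, f (x⁻¹ * y) * (starRingEnd ℂ) (χ y : ℂ) ∂mG =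
      (starRingEnd ℂ) (χ x : ℂ) * fourier mG f χ := by
    rw [← integral_mul_left_eq_self _ x, fourier, ← integral_const_mul]
    refine integral_congr_ae (Filter.Eventually.of_forall fun y => ?_)
    simp only [inv_mul_cancel_left, map_mul, Circle.coe_mul]
    ring
  rw [add_mul, one_mul, mul_assoc, ← h1, fourier, fourier, ← integral_const_mul, ← integral_add
    (integrable_mul_conj_char mG hf χ) ((integrable_mul_conj_char mG hg χ).const_mul u)]
  refine integral_congr_ae (Filter.Eventually.of_forall fun y => ?_)
  simp only
  ring

lemma norm_sq_one_add_of_norm_eq_one {w : ℂ} (hw : ‖w‖ = 1) : ‖1 + w‖ ^ 2 = 2 + 2 * w.re := by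
  have h := Complex.normSq_add 1 w
  rw [Complex.normSq_eq_norm_sq, Complex.normSq_eq_norm_sq, Complex.normSq_eq_norm_sq, hw] at h
  simp at h
  linarith

variable [MeasurableSpace (PontryaginDual G)] [BorelSpace (PontryaginDual G)]

/-- Finite measures on the dual group are determined by their Fourier transforms. -/
lemma measure_ext_of_integral_eval_eq (μ ν : Measure (PontryaginDual G)) [IsFiniteMeasure μ]
    [IsFiniteMeasure ν] (h : ∀ x : G, ∫ χ : PontryaginDual G, (χ x : ℂ) ∂μ = ∫ χ, (χ x : ℂ) ∂ν) :
    μ = ν := by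
  have : PolishSpace (PontryaginDual G) := polishSpace_of_locallyCompact_group _
  refine ext_of_forall_mem_subalgebra_integral_eq_of_polish (𝕜 := ℂ)
    (A := StarAlgebra.adjoin ℂ (Set.range (evalBCF (G := G)))) ?_ ?_
  · intro χ ψ hne
    obtain ⟨x, hx⟩ : ∃ x, χ x ≠ ψ x := by
      by_contra! h'
      exact hne (PontryaginDual.ext h')
    refine ⟨evalBCF x, ⟨BoundedContinuousFunction.toContinuousMapStarₐ ℂ (evalBCF x),
      ⟨evalBCF x, StarAlgebra.subset_adjoin ℂ _ ⟨x, rfl⟩, rfl⟩, rfl⟩, ?_⟩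
    exact fun h => hx (Circle.ext h)
  · intro g hg
    have hg' : g ∈ Submodule.span ℂ (Set.range (evalBCF (G := G))) := by
      -- The evaluations form a monoid closed under conjugation, so the star algebra they generate
      -- is just their linear span.
      have h1 : g ∈ (StarAlgebra.adjoin ℂ (Set.range (evalBCF (G := G)))).toSubalgebra := hg
      rw [StarAlgebra.adjoin_toSubalgebra, star_range_evalBCF, Set.union_self,
        ← Subalgebra.mem_toSubmodule, Algebra.adjoin_eq_span, ← MonoidHom.coe_mrange,
        Submonoid.closure_eq] at h1
      exact h1
    clear hg
    induction hg' using Submodule.span_induction with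
    | mem u hu => obtain ⟨x, rfl⟩ := hu; exact h x
    | zero => simp
    | add u w _ _ hu hw =>
      simp only [BoundedContinuousFunction.coe_add, Pi.add_apply]
      rw [integral_add (u.integrable μ) (w.integrable μ),
        integral_add (u.integrable ν) (w.integrable ν), hu, hw]
    | smul a u _ hu =>
      simp only [BoundedContinuousFunction.coe_smul]
      rw [integral_smul, integral_smul, hu]

lemma measurable_nnnorm_fourier_sq {f : G → ℂ} (hf : Integrable f mG) :
    Measurable fun χ => ‖fourier mG f χ‖₊ ^ 2 :=
  ((continuous_fourier mG hf).nnnorm.pow 2).measurable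

/-- The Fourier transform of a positive definite measure is unique, in weighted form. -/
lemma IsFourierTransform.withDensity_eq {Φ : (G → ℂ) → ℂ} {σ τ : Measure (PontryaginDual G)}
    (hσ : IsFourierTransform mG Φ σ) (hτ : IsFourierTransform mG Φ τ) {f : G → ℂ}
    (hf : Continuous f) (hfc : HasCompactSupport f) :
    σ.withDensity (fun χ => ((‖fourier mG f χ‖₊ ^ 2 : ℝ≥0) : ℝ≥0∞)) =
      τ.withDensity (fun χ => ((‖fourier mG f χ‖₊ ^ 2 : ℝ≥0) : ℝ≥0∞)) := by
  have hfi : Integrable f mG := hf.integrable_of_hasCompactSupport hfc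
  have hm := measurable_nnnorm_fourier_sq mG hfi
  have hfin : ∀ {σ : Measure (PontryaginDual G)}, IsFourierTransform mG Φ σ →
      IsFiniteMeasure (σ.withDensity (fun χ => ((‖fourier mG f χ‖₊ ^ 2 : ℝ≥0) : ℝ≥0∞))) := by
    intro σ hσ
    refine isFiniteMeasure_withDensity ?_
    have := (hσ.2 f hf hfc).1.2
    rw [hasFiniteIntegral_iff_enorm] at this
    refine (lt_of_le_of_lt (le_of_eq ?_) this).ne
    refine lintegral_congr fun χ => ?_
    rw [enorm_pow, enorm_norm]
    rfl
  have := hfin hσ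
  have := hfin hτ
  -- Polarization: the test function f + u f(x⁻¹ ·) multiplies |f̂|² by |1 + u conj(χ(x))|² = 2 + 2
  -- Re(u conj(χ(x))).
  have hre : ∀ (u : ℂ), ‖u‖ = 1 → ∀ x : G,
      ∫ χ, (2 + 2 * (u * (starRingEnd ℂ) (χ x : ℂ)).re) * ‖fourier mG f χ‖ ^ 2 ∂σ =
      ∫ χ, (2 + 2 * (u * (starRingEnd ℂ) (χ x : ℂ)).re) * ‖fourier mG f χ‖ ^ 2 ∂τ := by
    intro u hu x
    have hc : Continuous fun y => f y + u * f (x⁻¹ * y) := by fun_prop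
    have hs : HasCompactSupport fun y => f y + u * f (x⁻¹ * y) :=
      hfc.add ((hfc.comp_homeomorph (Homeomorph.mulLeft x⁻¹)).mul_left (f := fun _ => u))
    have h1 := (hσ.2 _ hc hs).2.trans (hτ.2 _ hc hs).2.symm
    have h2 : ∀ χ : PontryaginDual G, ‖fourier mG (fun y => f y + u * f (x⁻¹ * y)) χ‖ ^ 2 =
        (2 + 2 * (u * (starRingEnd ℂ) (χ x : ℂ)).re) * ‖fourier mG f χ‖ ^ 2 := fun χ => by
      rw [fourier_add_smul_translate mG hfi, norm_mul, mul_pow,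
        norm_sq_one_add_of_norm_eq_one (by simp [hu, Circle.norm_coe (χ x)])]
    simp_rw [h2] at h1
    exact_mod_cast h1
  set ν := σ.withDensity (fun χ => ((‖fourier mG f χ‖₊ ^ 2 : ℝ≥0) : ℝ≥0∞)) with hν
  set ν' := τ.withDensity (fun χ => ((‖fourier mG f χ‖₊ ^ 2 : ℝ≥0) : ℝ≥0∞)) with hν'
  have hint : ∀ (ν : Measure (PontryaginDual G)) [IsFiniteMeasure ν] (x : G),
      Integrable (fun χ : PontryaginDual G => (χ x : ℂ)) ν := fun ν _ x =>
    (evalBCF x).integrable ν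
  have hval : ∀ (ν : Measure (PontryaginDual G)) [IsFiniteMeasure ν] (u : ℂ) (x : G),
      ∫ χ : PontryaginDual G, (2 + 2 * (u * (starRingEnd ℂ) (χ x : ℂ)).re) ∂ν =
        2 * ν.real Set.univ + 2 * (u * (starRingEnd ℂ) (∫ χ, (χ x : ℂ) ∂ν)).re := by
    intro ν _ u x
    have h1 : Integrable (fun χ : PontryaginDual G => u * (starRingEnd ℂ) (χ x : ℂ)) ν :=
      ((Complex.conjLIE.toContinuousLinearEquiv.toContinuousLinearMap).integrable_comp
        (hint ν x)).const_mul u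
    have h2 := integral_re h1
    rw [integral_const_mul, integral_conj] at h2
    simp only [RCLike.re_eq_complex_re] at h2
    have h3 : Integrable (fun χ : PontryaginDual G => (u * (starRingEnd ℂ) (χ x : ℂ)).re) ν :=
      h1.re
    rw [integral_add (integrable_const _) (h3.const_mul 2), integral_const,
      integral_const_mul, h2, smul_eq_mul, mul_comm (2 : ℝ) (ν.real _)]
  have hνν : ∀ (u : ℂ), ‖u‖ = 1 → ∀ x : G,
      2 * ν.real Set.univ + 2 * (u * (starRingEnd ℂ) (∫ χ, (χ x : ℂ) ∂ν)).re =
      2 * ν'.real Set.univ + 2 * (u * (starRingEnd ℂ) (∫ χ, (χ x : ℂ) ∂ν')).re := by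
    intro u hu x
    rw [← hval, ← hval, hν, hν', integral_withDensity_eq_integral_smul hm,
      integral_withDensity_eq_integral_smul hm]
    convert hre u hu x using 4 <;>
      simp only [NNReal.smul_def, NNReal.coe_pow, coe_nnnorm, smul_eq_mul, mul_comm]
  refine measure_ext_of_integral_eval_eq ν ν' fun x => ?_
  -- The values u = 1 and u = -1 separate the total mass from the real part of the integral of χ(x);
  -- u = i then gives the imaginary part.
  have h1 := hνν 1 (by simp) x
  have h2 := hνν (-1) (by simp) x
  have h3 := hνν Complex.I (by simp) x
  simp only [one_mul, neg_mul, Complex.neg_re, Complex.conj_re, Complex.mul_re, Complex.I_re,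
    Complex.I_im, Complex.conj_im] at h1 h2 h3
  apply Complex.ext <;> linarith

/-- The Fourier transform of a positive definite measure is unique. -/
lemma IsFourierTransform.unique {Φ : (G → ℂ) → ℂ} {σ τ : Measure (PontryaginDual G)}
    (hσ : IsFourierTransform mG Φ σ) (hτ : IsFourierTransform mG Φ τ) : σ = τ := by
  rw [Measure.ext_iff_of_iUnion_eq_univ (iUnion_compactCovering (PontryaginDual G))]
  intro n
  have hK := isCompact_compactCovering (PontryaginDual G) n
  obtain ⟨f, hf, hfc, hf0⟩ := exists_half_le_norm_fourier mG hK
  have hfi : Integrable f mG := hf.integrable_of_hasCompactSupport hfc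
  have hm := (measurable_nnnorm_fourier_sq mG hfi).coe_nnreal_ennreal
  have h := congrArg (fun ν => ν.restrict (compactCovering (PontryaginDual G) n))
    (hσ.withDensity_eq mG hτ hf hfc)
  simp only [restrict_withDensity hK.measurableSet] at h
  -- On a compact piece |f̂|² is bounded away from zero, so the density can be divided out.
  have key : ∀ σ : Measure (PontryaginDual G),
      ((σ.restrict (compactCovering (PontryaginDual G) n)).withDensity
        (fun χ => ((‖fourier mG f χ‖₊ ^ 2 : ℝ≥0) : ℝ≥0∞))).withDensity
        (fun χ => ((‖fourier mG f χ‖₊ ^ 2 : ℝ≥0) : ℝ≥0∞)⁻¹) =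
      σ.restrict (compactCovering (PontryaginDual G) n) := fun σ => by
    refine withDensity_inv_same hm ?_ (Filter.Eventually.of_forall fun _ => ENNReal.coe_ne_top)
    refine ae_restrict_of_forall_mem hK.measurableSet fun χ hχ => ?_
    have : 0 < ‖fourier mG f χ‖ := lt_of_lt_of_le (by norm_num) (hf0 χ hχ)
    simpa using this
  rw [← key σ, ← key τ, h]

end Dual

/-! ### Counting measures on cosets -/

section Orbit

variable {L : Type*} [CommGroup L] [MeasurableSpace L] (Γ : Subgroup L)

/-- The counting measure on the coset `ω`, as a measure on `L`. -/
def orbitMeasure (ω : L ⧸ Γ) : Measure L :=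
  Measure.sum fun γ : Γ => Measure.dirac ((γ : L) * ω.out)

variable [MeasurableSingletonClass L]

/-- The chosen representative `ω.out` differs from l by an element of Γ, and reindexing Γ by it
shows that the choice is irrelevant. -/
lemma lintegral_orbitMeasure (f : L → ℝ≥0∞) (l : L) :
    ∫⁻ x, f x ∂orbitMeasure Γ (l : L ⧸ Γ) = ∑' γ : Γ, f (γ * l) := by
  rw [orbitMeasure, lintegral_sum_measure]
  simp only [lintegral_dirac]
  obtain ⟨h, hh⟩ := QuotientGroup.mk_out_eq_mul Γ l
  rw [hh, ← (Equiv.mulRight h).tsum_eq fun γ : Γ => f (γ * l)]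
  refine tsum_congr fun γ => ?_
  rw [Equiv.coe_mulRight, Subgroup.coe_mul, mul_comm l, mul_assoc]

lemma orbitMeasure_apply {B : Set L} (hB : MeasurableSet B) (l : L) :
    orbitMeasure Γ (l : L ⧸ Γ) B = ∑' γ : Γ, B.indicator 1 ((γ : L) * l) := by
  rw [← lintegral_orbitMeasure, lintegral_indicator_one hB]

variable [Countable Γ]

lemma ae_orbitMeasure (ω : L ⧸ Γ) : ∀ᵐ x : L ∂orbitMeasure Γ ω, (x : L ⧸ Γ) = ω := by
  rw [orbitMeasure, Measure.ae_sum_iff]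
  intro γ
  rw [ae_dirac_eq, Filter.eventually_pure, ← QuotientGroup.out_eq' ω, QuotientGroup.eq]
  simp [mul_comm]

variable [MeasurableMul₂ L]

lemma measurable_orbitMeasure : Measurable (orbitMeasure Γ) := by
  refine Measure.measurable_of_measurable_coe _ fun B hB => ?_
  rw [QuotientGroup.measurable_from_quotient]
  have : (fun ω => orbitMeasure Γ ω B) ∘ ((↑) : L → L ⧸ Γ) =
      fun l => ∑' γ : Γ, B.indicator 1 ((γ : L) * l) := funext fun l =>
    orbitMeasure_apply Γ hB l
  rw [this]
  exact Measurable.tsum fun γ =>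
    (measurable_one.indicator hB).comp (measurable_const_mul (γ : L))

lemma lintegral_orbitMeasure_mul (f : L → ℝ≥0∞) (l : L) (ω : L ⧸ Γ) :
    ∫⁻ x, f (l * x) ∂orbitMeasure Γ ω = ∫⁻ x, f x ∂orbitMeasure Γ ((l : L ⧸ Γ) * ω) := by
  induction ω using QuotientGroup.induction_on with
  | H k =>
    rw [← QuotientGroup.mk_mul, lintegral_orbitMeasure, lintegral_orbitMeasure]
    simp only [mul_left_comm]

end Orbit

/-! ### Lattices, invariant measures on the quotient and unfolding -/

section Lattice

variable {L : Type*} [CommGroup L] [TopologicalSpace L] [IsTopologicalGroup L] [T2Space L]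
  [LocallyCompactSpace L] [SecondCountableTopology L] [MeasurableSpace L] [BorelSpace L]
  (Γ : Subgroup L) [DiscreteTopology Γ]

instance countable_of_discreteTopology_subgroup : Countable Γ := countable_of_Lindelof_of_discrete

/-- A coset of a discrete subgroup has boundedly many points in a compact set. -/
lemma exists_orbitMeasure_le {K : Set L} (hK : IsCompact K) :
    ∃ N : ℕ, ∀ ω : L ⧸ Γ, orbitMeasure Γ ω K ≤ N := by
  obtain ⟨U, hU, hUΓ⟩ : ∃ U ∈ nhds (1 : L), ∀ γ ∈ Γ, γ ∈ U → γ = 1 := by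
    have h : IsOpen ({1} : Set Γ) := isOpen_discrete _
    obtain ⟨U, hU, hUe⟩ := isOpen_induced_iff.1 h
    refine ⟨U, hU.mem_nhds ?_, fun γ hγ hγU => ?_⟩
    · have : (1 : Γ) ∈ Subtype.val ⁻¹' U := by rw [hUe]; rfl
      exact this
    · have : (⟨γ, hγ⟩ : Γ) ∈ Subtype.val ⁻¹' U := hγU
      rw [hUe] at this
      exact congrArg Subtype.val this
  -- Two points of one coset in the same translate kV differ by an element of Γ ∩ U = {1}, so each
  -- translate in a finite cover of K contains at most one point of the coset.
  obtain ⟨V, hV, hVU⟩ := exists_nhds_split_inv hU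
  have hcov : ∀ k ∈ K, (fun x => k⁻¹ * x) ⁻¹' interior V ∈ nhds k := fun k _ => by
    refine (isOpen_interior.preimage (by fun_prop)).mem_nhds ?_
    simpa using mem_interior_iff_mem_nhds.2 hV
  obtain ⟨t, -, ht⟩ := hK.elim_nhds_subcover _ hcov
  refine ⟨t.card, fun ω => ?_⟩
  calc orbitMeasure Γ ω K ≤ orbitMeasure Γ ω (⋃ k ∈ t, (fun x => k⁻¹ * x) ⁻¹' interior V) :=
        measure_mono ht
    _ ≤ ∑ k ∈ t, orbitMeasure Γ ω ((fun x => k⁻¹ * x) ⁻¹' interior V) :=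
        measure_biUnion_finset_le _ _
    _ ≤ ∑ k ∈ t, 1 := by
        refine Finset.sum_le_sum fun k _ => ?_
        induction ω using QuotientGroup.induction_on with
        | H l =>
          rw [orbitMeasure_apply Γ (isOpen_interior.preimage (by fun_prop)).measurableSet]
          by_cases h : ∃ γ : Γ, (γ : L) * l ∈ (fun x => k⁻¹ * x) ⁻¹' interior V
          · obtain ⟨γ, hγ⟩ := h
            rw [tsum_eq_single γ]
            · exact Set.indicator_le_self' (by simp) _
            · intro δ hδ
              refine Set.indicator_of_notMem (fun hδ' => hδ ?_) _
              have h1 := hVU _ (interior_subset hδ') _ (interior_subset hγ)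
              have h2 : k⁻¹ * (δ * l) / (k⁻¹ * (γ * l)) = (δ * γ⁻¹ : Γ) := by
                rw [mul_div_mul_left_eq_div, mul_div_mul_right_eq_div, div_eq_mul_inv]
                simp
              rw [h2] at h1
              have h3 := hUΓ _ (SetLike.coe_mem _) h1
              exact mul_inv_eq_one.1 (Subtype.ext h3)
          · push Not at h
            have : ∀ γ : Γ, ((fun x => k⁻¹ * x) ⁻¹' interior V).indicator (1 : L → ℝ≥0∞)
                ((γ : L) * l) = 0 := fun γ => Set.indicator_of_notMem (h γ) _
            simp [this]
    _ = t.card := by simp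

instance isFiniteMeasureOnCompacts_orbitMeasure (ω : L ⧸ Γ) :
    IsFiniteMeasureOnCompacts (orbitMeasure Γ ω) where
  lt_top_of_isCompact := fun _ hK => by
    obtain ⟨N, hN⟩ := exists_orbitMeasure_le Γ hK
    exact (hN ω).trans_lt (by simp)

instance isClosed_of_discreteTopology_subgroup : IsClosed (Γ : Set L) :=
  Subgroup.isClosed_of_discrete

/-- The quotient σ-algebra is the Borel one because L is Polish and Γ is closed. -/
instance borelSpace_quotient_lattice : BorelSpace (L ⧸ Γ) := by
  have := polishSpace_of_locallyCompact_group L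
  infer_instance

variable (P : Measure (L ⧸ Γ)) [IsProbabilityMeasure P]

/-- An invariant probability measure exists on `L ⧸ Γ` only if the quotient is compact. -/
lemma compactSpace_quotient [P.IsMulLeftInvariant] : CompactSpace (L ⧸ Γ) := by
  by_contra h
  have : NoncompactSpace (L ⧸ Γ) := not_compactSpace_iff.1 h
  have : NeZero P := ⟨IsProbabilityMeasure.ne_zero P⟩
  have := isOpenPosMeasure_of_mulLeftInvariant_of_regular (μ := P)
  -- On a noncompact group an invariant measure that is positive on open sets has infinite mass.
  have := measure_univ_of_isMulLeftInvariant P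
  simp at this

/-- A probability measure that is invariant under a dense set of translations is invariant. -/
lemma isMulLeftInvariant_of_dense {D : Set L} (hD : Dense D)
    (h : ∀ l ∈ D, P.map (fun ω => (l : L ⧸ Γ) * ω) = P) : P.IsMulLeftInvariant where
  map_mul_left_eq_self := fun ω₀ => by
    obtain ⟨l₀, rfl⟩ := QuotientGroup.mk_surjective ω₀
    have hm : ∀ ω₀ : L ⧸ Γ, Measurable fun ω => ω₀ * ω := fun ω₀ =>
      (continuous_const_mul ω₀).measurable
    have : IsFiniteMeasure (P.map (fun ω => (l₀ : L ⧸ Γ) * ω)) := inferInstance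
    refine ext_of_forall_integral_eq_of_IsFiniteMeasure fun f => ?_
    have hmap : ∀ ω₀ : L ⧸ Γ, ∫ ω, f ω ∂(P.map (fun ω => ω₀ * ω)) = ∫ ω, f (ω₀ * ω) ∂P :=
      fun ω₀ => integral_map (hm ω₀).aemeasurable f.continuous.aestronglyMeasurable
    -- Dominated convergence gives continuity in l, so the equality on D extends to all of L.
    have hcont : Continuous fun l : L => ∫ ω, f ((l : L ⧸ Γ) * ω) ∂P := by
      refine continuous_of_dominated (bound := fun _ => ‖f‖)
        (fun l => (f.continuous.comp (continuous_const_mul _)).aestronglyMeasurable)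
        (fun l => Filter.Eventually.of_forall fun ω => f.norm_coe_le_norm _)
        (integrable_const _) (Filter.Eventually.of_forall fun ω => ?_)
      exact f.continuous.comp ((continuous_mul_const ω).comp QuotientGroup.continuous_mk)
    have heq : (fun l : L => ∫ ω, f ((l : L ⧸ Γ) * ω) ∂P) = fun _ => ∫ ω, f ω ∂P := by
      refine hcont.ext_on hD continuous_const fun l hl => ?_
      simp only
      rw [← hmap, h l hl]
    rw [hmap]
    exact congrFun heq l₀

/-- The invariant measure on `L` obtained by integrating the counting measures on cosets. -/
def unfoldMeasure : Measure L := P.bind (orbitMeasure Γ)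

lemma lintegral_unfoldMeasure {f : L → ℝ≥0∞} (hf : Measurable f) :
    ∫⁻ x, f x ∂unfoldMeasure Γ P = ∫⁻ ω, ∫⁻ x, f x ∂orbitMeasure Γ ω ∂P :=
  Measure.lintegral_bind (measurable_orbitMeasure Γ).aemeasurable hf.aemeasurable

lemma unfoldMeasure_apply {B : Set L} (hB : MeasurableSet B) :
    unfoldMeasure Γ P B = ∫⁻ ω, orbitMeasure Γ ω B ∂P :=
  Measure.bind_apply hB (measurable_orbitMeasure Γ).aemeasurable

instance isFiniteMeasureOnCompacts_unfoldMeasure :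
    IsFiniteMeasureOnCompacts (unfoldMeasure Γ P) where
  lt_top_of_isCompact := fun K hK => by
    obtain ⟨N, hN⟩ := exists_orbitMeasure_le Γ hK
    rw [unfoldMeasure_apply Γ P hK.measurableSet]
    calc _ ≤ ∫⁻ _, (N : ℝ≥0∞) ∂P := lintegral_mono hN
      _ < ∞ := by simp

instance isMulLeftInvariant_unfoldMeasure [P.IsMulLeftInvariant] :
    (unfoldMeasure Γ P).IsMulLeftInvariant where
  map_mul_left_eq_self := fun l => by
    ext B hB
    rw [Measure.map_apply (measurable_const_mul l) hB,
      unfoldMeasure_apply Γ P (measurable_const_mul l hB), unfoldMeasure_apply Γ P hB]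
    rw [← lintegral_mul_left_eq_self (fun ω => orbitMeasure Γ ω B) (l : L ⧸ Γ)]
    refine lintegral_congr fun ω => ?_
    have h := lintegral_orbitMeasure_mul Γ (B.indicator 1) l ω
    rw [lintegral_indicator_one hB] at h
    rw [← h, ← lintegral_indicator_one (measurable_const_mul l hB)]
    rfl

open scoped Pointwise in
/-- **Unfolding**: the invariant measure on the quotient has the inverse covolume as density. -/
theorem unfoldMeasure_eq [P.IsMulLeftInvariant] (m : Measure L) [m.IsHaarMeasure]
    (hΓ : IsLattice m Γ) :
    unfoldMeasure Γ P = (covol m Γ)⁻¹ • m ∧ covol m Γ ≠ 0 ∧ covol m Γ ≠ ∞ := by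
  obtain ⟨F, hFm, hF, hFfin⟩ := hΓ.exists_isFundamentalDomain
  have hcov : covol m Γ = m F := hF.covolume_eq_volume m
  -- Uniqueness of Haar measure leaves only the constant c, which is found by evaluating on the
  -- fundamental domain: almost every coset meets F exactly once, hence c · m(F) = 1.
  have hM := Measure.isMulLeftInvariant_eq_smul (unfoldMeasure Γ P) m
  set c := (unfoldMeasure Γ P).haarScalarFactor m
  have hmeas : Measurable fun ω => orbitMeasure Γ ω F :=
    (Measure.measurable_coe hFm).comp (measurable_orbitMeasure Γ)
  have h1 : ∀ᵐ x : L ∂m, orbitMeasure Γ (x : L ⧸ Γ) F = 1 := by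
    have hdis : ∀ᵐ x ∂m, ∀ γ δ : Γ, γ ≠ δ → ¬ (x ∈ γ • F ∧ x ∈ δ • F) := by
      rw [ae_all_iff]
      intro γ
      rw [ae_all_iff]
      intro δ
      by_cases h : γ = δ
      · simp [h]
      · have h0 : m (γ • F ∩ δ • F) = 0 := hF.aedisjoint h
        filter_upwards [measure_eq_zero_iff_ae_notMem.1 h0] with x hx _ hx'
        exact hx hx'
    filter_upwards [hF.ae_covers, hdis] with x ⟨γ, hγ⟩ hx
    rw [orbitMeasure_apply Γ hFm, tsum_eq_single γ]
    · exact Set.indicator_of_mem (f := (1 : L → ℝ≥0∞)) hγ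
    · intro δ hδ
      refine Set.indicator_of_notMem (fun h => ?_) _
      refine hx γ⁻¹ δ⁻¹ (fun h => hδ (inv_injective h).symm) ⟨?_, ?_⟩
      · rwa [Set.mem_inv_smul_set_iff]
      · rwa [Set.mem_inv_smul_set_iff]
  -- The preimage of the exceptional set N is m-null, hence null for the unfolded measure. Each
  -- coset in N lies entirely in this preimage and has positive counting measure, so P(N) = 0.
  have h2 : ∀ᵐ ω ∂P, orbitMeasure Γ ω F = 1 := by
    set N : Set (L ⧸ Γ) := {ω | orbitMeasure Γ ω F ≠ 1} with hN
    have hNm : MeasurableSet N := (hmeas (measurableSet_singleton 1)).compl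
    have hNm' : MeasurableSet (((↑) : L → L ⧸ Γ) ⁻¹' N) := QuotientGroup.measurable_coe hNm
    have h0 : unfoldMeasure Γ P (((↑) : L → L ⧸ Γ) ⁻¹' N) = 0 := by
      rw [hM, Measure.smul_apply]
      have : m (((↑) : L → L ⧸ Γ) ⁻¹' N) = 0 := h1
      rw [this, smul_zero]
    have hNμ : Measurable fun ω => orbitMeasure Γ ω (((↑) : L → L ⧸ Γ) ⁻¹' N) :=
      (Measure.measurable_coe hNm').comp (measurable_orbitMeasure Γ)
    rw [unfoldMeasure_apply Γ P hNm', lintegral_eq_zero_iff hNμ] at h0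
    filter_upwards [h0] with ω hω
    by_contra hne
    induction ω using QuotientGroup.induction_on with
    | H l =>
      rw [orbitMeasure_apply Γ hNm', Pi.zero_apply, ENNReal.tsum_eq_zero] at hω
      have := hω 1
      rw [Subgroup.coe_one, one_mul, Set.indicator_of_mem (show l ∈ _ from hne)] at this
      simp at this
  have h3 : (c : ℝ≥0∞) * m F = 1 := by
    have h4 : unfoldMeasure Γ P F = 1 := by
      rw [unfoldMeasure_apply Γ P hFm, lintegral_congr_ae h2]
      simp
    rw [hM] at h4
    exact h4
  have h0 : m F ≠ 0 := fun h => by simp [h] at h3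
  refine ⟨?_, hcov ▸ h0, hcov ▸ hFfin.ne⟩
  rw [hcov, ← ENNReal.eq_inv_of_mul_eq_one_left h3, hM]
  rfl

end Lattice

/-! ### The cut-and-project process: invariance, intensity, autocorrelation -/

section CutProjectMeasure

variable {G : Type*} [CommGroup G] [TopologicalSpace G] [IsTopologicalGroup G] [T2Space G]
  [LocallyCompactSpace G] [SecondCountableTopology G] [MeasurableSpace G] [BorelSpace G]
  {H : Type*} [CommGroup H] [TopologicalSpace H] [IsTopologicalGroup H] [T2Space H]
  [LocallyCompactSpace H] [SecondCountableTopology H] [MeasurableSpace H] [BorelSpace H]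
  (Γ : Subgroup (G × H)) [DiscreteTopology Γ] (W : Set H)

lemma quotientAction_smul (g : G) (ω : (G × H) ⧸ Γ) :
    g • ω = (((g⁻¹, 1) : G × H) : (G × H) ⧸ Γ) * ω := by
  induction ω using QuotientGroup.induction_on with
  | H l => rfl

/-- Injectivity of the projection to G ensures that distinct points of the coset in G × W give
distinct points of the model set, so no multiplicity is lost when the coset is pushed forward. -/
lemma process_eq (hinj : Set.InjOn Prod.fst (Γ : Set (G × H))) (hW : MeasurableSet W)
    (ω : (G × H) ⧸ Γ) :
    process Γ W ω = ((orbitMeasure Γ ω).restrict (Set.univ ×ˢ W)).map Prod.fst := by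
  induction ω using QuotientGroup.induction_on with
  | H l =>
    ext A hA
    rw [Measure.map_apply measurable_fst hA,
      Measure.restrict_apply (measurable_fst hA),
      orbitMeasure_apply Γ ((measurable_fst hA).inter (MeasurableSet.univ.prod hW))]
    change diracComb (translatedModelSet Γ W l) A = _
    rw [diracComb, Measure.sum_apply _ hA]
    simp only [Measure.dirac_apply' _ hA]
    let S : Set Γ := {γ | γ.1.2 * l.2 ∈ W}
    let e : S ≃ translatedModelSet Γ W l := Equiv.ofBijective
      (fun γ => ⟨γ.1.1.1 * l.1, (mem_translatedModelSet Γ W l _).2 ⟨γ.1.1, γ.1.2, rfl, γ.2⟩⟩) (by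
        constructor
        · intro γ δ h
          have h1 := mul_right_cancel (congrArg Subtype.val h)
          exact Subtype.ext (Subtype.ext (hinj γ.1.2 δ.1.2 h1))
        · rintro ⟨x, hx⟩
          obtain ⟨γ, hγ, h1, h2⟩ := (mem_translatedModelSet Γ W l _).1 hx
          exact ⟨⟨⟨γ, hγ⟩, h2⟩, Subtype.ext h1⟩)
    rw [← e.tsum_eq fun x => A.indicator 1 (x : G)]
    change ∑' γ : S, A.indicator (1 : G → ℝ≥0∞) (γ.1.1.1 * l.1) = _
    rw [tsum_subtype S fun γ : Γ => A.indicator (1 : G → ℝ≥0∞) (γ.1.1 * l.1)]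
    refine tsum_congr fun γ => ?_
    by_cases h2 : γ.1.2 * l.2 ∈ W <;> by_cases h1 : γ.1.1 * l.1 ∈ A <;>
      simp [Set.indicator, S, h1, h2]

variable {W} (hinj : Set.InjOn Prod.fst (Γ : Set (G × H))) (hW : MeasurableSet W)

include hinj hW in
lemma process_apply {A : Set G} (hA : MeasurableSet A) (ω : (G × H) ⧸ Γ) :
    process Γ W ω A = orbitMeasure Γ ω (A ×ˢ W) := by
  rw [process_eq Γ W hinj hW, Measure.map_apply measurable_fst hA,
    Measure.restrict_apply (measurable_fst hA)]
  congr 1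
  ext x
  simp

include hinj hW in
lemma measurable_process : Measurable (process Γ W) := by
  refine Measure.measurable_of_measurable_coe _ fun A hA => ?_
  simp_rw [process_apply Γ hinj hW hA]
  exact (Measure.measurable_coe (hA.prod hW)).comp (measurable_orbitMeasure Γ)

instance sFinite_process (ω : (G × H) ⧸ Γ) (W : Set H) : SFinite (process Γ W ω) := by
  have : Countable (randomModelSet Γ W ω) := by
    induction ω using QuotientGroup.induction_on with
    | H l =>
      change Countable (translatedModelSet Γ W l)
      refine Set.Countable.to_subtype ((Set.countable_range fun γ : Γ => γ.1.1 * l.1).mono ?_)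
      intro x hx
      obtain ⟨γ, hγ, h1, -⟩ := (mem_translatedModelSet Γ W l x).1 hx
      exact ⟨⟨γ, hγ⟩, h1⟩
  unfold process diracComb
  infer_instance

include hinj hW in
lemma exists_process_le (hWc : IsCompact (closure W)) {K : Set G} (hK : IsCompact K) :
    ∃ N : ℕ, ∀ ω, process Γ W ω K ≤ N := by
  obtain ⟨N, hN⟩ := exists_orbitMeasure_le Γ (hK.prod hWc)
  refine ⟨N, fun ω => ?_⟩
  rw [process_apply Γ hinj hW hK.measurableSet]
  exact (measure_mono (Set.prod_mono le_rfl subset_closure)).trans (hN ω)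

include hinj hW in
lemma isFiniteMeasureOnCompacts_process (hWc : IsCompact (closure W)) (ω : (G × H) ⧸ Γ) :
    IsFiniteMeasureOnCompacts (process Γ W ω) where
  lt_top_of_isCompact := fun _ hK => by
    obtain ⟨N, hN⟩ := exists_process_le Γ hinj hW hWc hK
    exact (hN ω).trans_lt (by simp)

include hinj hW in
lemma process_smul (g : G) (ω : (G × H) ⧸ Γ) :
    process Γ W (g • ω) = (process Γ W ω).map (fun x => x * g⁻¹) := by
  ext A hA
  have hA' : MeasurableSet ((fun x => x * g⁻¹) ⁻¹' A) := measurable_mul_const _ hA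
  rw [Measure.map_apply (measurable_mul_const _) hA, process_apply Γ hinj hW hA,
    process_apply Γ hinj hW hA', quotientAction_smul,
    ← lintegral_indicator_one (hA.prod hW), ← lintegral_orbitMeasure_mul,
    ← lintegral_indicator_one (hA'.prod hW)]
  refine lintegral_congr fun x => ?_
  have : ((g⁻¹, 1) * x ∈ A ×ˢ W) ↔ x ∈ ((fun x => x * g⁻¹) ⁻¹' A) ×ˢ W := by
    simp [mul_comm g⁻¹]
  by_cases h : (g⁻¹, 1) * x ∈ A ×ˢ W
  · rw [Set.indicator_of_mem h, Set.indicator_of_mem (this.1 h)]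
    rfl
  · rw [Set.indicator_of_notMem h, Set.indicator_of_notMem (mt this.2 h)]

variable (P : Measure ((G × H) ⧸ Γ)) [IsProbabilityMeasure P]

include hinj hW in
lemma isInvariantRandomMeasure_process (hWc : IsCompact (closure W))
    (hP : ∀ g : G, MeasurePreserving (fun ω : (G × H) ⧸ Γ => g • ω) P P) :
    IsInvariantRandomMeasure P (process Γ W) where
  isProbabilityMeasure := inferInstance
  measurable_smul := by
    simp_rw [quotientAction_smul]
    have : Continuous fun x : G × ((G × H) ⧸ Γ) =>
        (((x.1⁻¹, 1) : G × H) : (G × H) ⧸ Γ) * x.2 :=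
      (QuotientGroup.continuous_mk.comp (by fun_prop)).mul continuous_snd
    exact this.measurable
  measurePreserving_smul := hP
  measurable := measurable_process Γ hinj hW
  isFiniteMeasureOnCompacts := isFiniteMeasureOnCompacts_process Γ hinj hW hWc
  equivariant := process_smul Γ hinj hW
  locallySquareIntegrable := by
    rintro B - ⟨K, hK, hBK⟩
    obtain ⟨N, hN⟩ := exists_process_le Γ hinj hW hWc hK
    calc _ ≤ ∫⁻ _, (N : ℝ≥0∞) ^ 2 ∂P := lintegral_mono fun ω =>
          pow_le_pow_left₀ (by simp) ((measure_mono hBK).trans (hN ω)) 2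
      _ < ∞ := by simp

/-- Invariance under `G` alone implies invariance under `G × H`, as `Γ` is dense in `H`. -/
lemma isMulLeftInvariant_of_measurePreserving
    (hdense : Dense (Prod.snd '' (Γ : Set (G × H))))
    (hP : ∀ g : G, MeasurePreserving (fun ω : (G × H) ⧸ Γ => g • ω) P P) :
    P.IsMulLeftInvariant := by
  refine isMulLeftInvariant_of_dense Γ P (D := Set.univ ×ˢ (Prod.snd '' (Γ : Set (G × H))))
    (dense_univ.prod hdense) ?_
  rintro ⟨g, _⟩ ⟨-, ⟨γ, hγ, rfl⟩⟩
  -- Modulo Γ, the element (g, γ₂) equals (g γ₁⁻¹, 1), so its translation is the action of γ₁ g⁻¹ ∈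
  -- G.
  have h := (hP (γ.1 * g⁻¹)).map_eq
  simp_rw [quotientAction_smul] at h
  convert h using 4
  rw [QuotientGroup.eq]
  convert Γ.inv_mem hγ using 1
  ext <;> simp

variable (mG : Measure G) [mG.IsHaarMeasure] (mH : Measure H) [mH.IsHaarMeasure]

include hinj hW in
lemma isIntensity_process [P.IsMulLeftInvariant] (hΓ : IsLattice (mG.prod mH) Γ)
    (hWc : IsCompact (closure W)) :
    IsIntensity mG P (process Γ W) ((covol (mG.prod mH) Γ)⁻¹ * mH W).toNNReal := by
  intro A hA
  obtain ⟨hM, h0, -⟩ := unfoldMeasure_eq Γ P (mG.prod mH) hΓ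
  have hWfin : mH W ≠ ∞ := ((measure_mono subset_closure).trans_lt hWc.measure_lt_top).ne
  rw [ENNReal.coe_toNNReal (ENNReal.mul_ne_top (ENNReal.inv_ne_top.2 h0) hWfin), firstMoment]
  simp_rw [process_apply Γ hinj hW hA]
  rw [← unfoldMeasure_apply Γ P (hA.prod hW), hM, Measure.smul_apply, Measure.prod_prod,
    smul_eq_mul, mul_assoc, mul_comm (mH W)]

/-- The number of pairs of points in `B`, counted from the second point. -/
def pairCount (W : Set H) (B : Set (G × G)) (l : G × H) : ℝ≥0∞ :=
  ∑' δ : Γ, B.indicator 1 (δ.1.1 * l.1, l.1) * (W.indicator 1 (δ.1.2 * l.2) * W.indicator 1 l.2)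

include hW in
lemma measurable_pairCount {B : Set (G × G)} (hB : MeasurableSet B) :
    Measurable (pairCount Γ W B) := by
  refine Measurable.tsum fun δ => ?_
  have h1 : Measurable fun x => B.indicator (1 : G × G → ℝ≥0∞) x := measurable_one.indicator hB
  have h2 : Measurable fun x => W.indicator (1 : H → ℝ≥0∞) x := measurable_one.indicator hW
  exact (h1.comp (by fun_prop)).mul ((h2.comp (by fun_prop)).mul (h2.comp (by fun_prop)))

include hinj hW in
lemma lintegral_process {f : G → ℝ≥0∞} (hf : Measurable f) (ω : (G × H) ⧸ Γ) :
    ∫⁻ x, f x ∂process Γ W ω = ∫⁻ x, f x.1 * W.indicator 1 x.2 ∂orbitMeasure Γ ω := by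
  rw [process_eq Γ W hinj hW, lintegral_map hf measurable_fst,
    ← lintegral_indicator (MeasurableSet.univ.prod hW)]
  refine lintegral_congr fun x => ?_
  by_cases h : x.2 ∈ W <;> simp [Set.indicator, h]

-- Once a point x of the coset ω is fixed, the coset is Γx and the partners of x are the δx with δ ∈
-- Γ. This writes the pair count as a single sum over the coset, to which unfolding applies.
include hinj hW in
lemma process_prod_apply {B : Set (G × G)} (hB : MeasurableSet B) (ω : (G × H) ⧸ Γ) :
    ((process Γ W ω).prod (process Γ W ω)) B =
      ∫⁻ x, pairCount Γ W B x ∂orbitMeasure Γ ω := by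
  rw [Measure.prod_apply_symm hB,
    lintegral_process Γ hinj hW (measurable_measure_prodMk_right hB)]
  refine lintegral_congr_ae ?_
  filter_upwards [ae_orbitMeasure Γ ω] with x hx
  have hBx : MeasurableSet ((fun y => (y, x.1)) ⁻¹' B) := measurable_prodMk_right hB
  rw [← hx, process_apply Γ hinj hW hBx, orbitMeasure_apply Γ (hBx.prod hW), pairCount,
    ← ENNReal.tsum_mul_right]
  refine tsum_congr fun δ => ?_
  rw [← mul_assoc]
  congr 1
  by_cases h1 : (δ.1.1 * x.1, x.1) ∈ B <;> by_cases h2 : δ.1.2 * x.2 ∈ W <;>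
    simp [Set.indicator, h1, h2]

include hinj hW in
lemma measurable_process_prod :
    Measurable fun ω => (process Γ W ω).prod (process Γ W ω) := by
  refine Measure.measurable_of_measurable_coe _ fun B hB => ?_
  simp_rw [process_prod_apply Γ hinj hW hB]
  exact (Measure.measurable_lintegral (measurable_pairCount Γ hW hB)).comp
    (measurable_orbitMeasure Γ)

/-- The autocorrelation of the cut-and-project process. -/
def autocorrelation (W : Set H) : Measure G :=
  (covol (mG.prod mH) Γ)⁻¹ • Measure.sum fun δ : Γ =>
    mH ((fun h => δ.1.2 * h) ⁻¹' W ∩ W) • Measure.dirac δ.1.1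

/-- Only δ with δ₂ in the compact set C = cl(W) cl(W)⁻¹ contribute, each with weight at most m_H(W),
and Γ has finitely many points in K × C. -/
lemma isFiniteMeasureOnCompacts_autocorrelation (hcov : covol (mG.prod mH) Γ ≠ 0)
    (hWc : IsCompact (closure W)) :
    IsFiniteMeasureOnCompacts (autocorrelation Γ mG mH W) where
  lt_top_of_isCompact := fun K hK => by
    set C : Set H := (fun p : H × H => p.1 * p.2⁻¹) '' (closure W ×ˢ closure W)
    have hC : IsCompact C := (hWc.prod hWc).image (by fun_prop)
    have hWfin : mH W < ∞ := (measure_mono subset_closure).trans_lt hWc.measure_lt_top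
    have hfin : orbitMeasure Γ ((1 : G × H) : (G × H) ⧸ Γ) (K ×ˢ C) < ∞ :=
      (hK.prod hC).measure_lt_top
    rw [orbitMeasure_apply Γ (hK.prod hC).measurableSet] at hfin
    rw [autocorrelation, Measure.smul_apply, Measure.sum_apply _ hK.measurableSet]
    refine ENNReal.mul_lt_top (ENNReal.inv_ne_top.2 hcov).lt_top ?_
    refine lt_of_le_of_lt ?_ (ENNReal.mul_lt_top hWfin hfin)
    rw [← ENNReal.tsum_mul_left]
    refine ENNReal.tsum_le_tsum fun δ => ?_
    rw [Measure.smul_apply, Measure.dirac_apply' _ hK.measurableSet, smul_eq_mul, mul_one]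
    by_cases h : ((fun h => δ.1.2 * h) ⁻¹' W ∩ W).Nonempty
    · obtain ⟨h, h1, h2⟩ := h
      have hδ : δ.1.2 ∈ C := ⟨(δ.1.2 * h, h), ⟨subset_closure h1, subset_closure h2⟩, by simp⟩
      refine mul_le_mul' (measure_mono Set.inter_subset_right) ?_
      by_cases hK' : δ.1.1 ∈ K <;> simp [Set.indicator, hK', hδ]
    · rw [Set.not_nonempty_iff_eq_empty.1 h]
      simp

-- After unfolding, the term of δ is a product of an integral over G, which is the slice of the
-- sheared set at δ₁, and one over H, which is m_H(δ₂⁻¹W ∩ W).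
include hinj hW in
lemma isAutocorrelation_autocorrelation [P.IsMulLeftInvariant]
    (hΓ : IsLattice (mG.prod mH) Γ) (hWc : IsCompact (closure W)) :
    IsAutocorrelation mG P (process Γ W) (autocorrelation Γ mG mH W) := by
  obtain ⟨hM, h0, -⟩ := unfoldMeasure_eq Γ P (mG.prod mH) hΓ
  refine ⟨isFiniteMeasureOnCompacts_autocorrelation Γ mG mH h0 hWc, fun B hB => ?_⟩
  have hm : Measurable fun x : G × G => (x.1 * x.2, x.2) := by fun_prop
  rw [secondMoment]
  simp_rw [process_prod_apply Γ hinj hW hB]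
  rw [← lintegral_unfoldMeasure Γ P (measurable_pairCount Γ hW hB), hM, lintegral_smul_measure,
    Measure.map_apply hm hB, Measure.prod_apply (hm hB), autocorrelation, lintegral_smul_measure,
    lintegral_sum_measure]
  congr 1
  unfold pairCount
  have h1 : Measurable fun x => B.indicator (1 : G × G → ℝ≥0∞) x := measurable_one.indicator hB
  have h2 : Measurable fun x => W.indicator (1 : H → ℝ≥0∞) x := measurable_one.indicator hW
  have h3 : ∀ δ : Γ, Measurable fun l : G × H => B.indicator (1 : G × G → ℝ≥0∞)
      (δ.1.1 * l.1, l.1) * (W.indicator (1 : H → ℝ≥0∞) (δ.1.2 * l.2) * W.indicator 1 l.2) :=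
    fun δ => (h1.comp (by fun_prop)).mul ((h2.comp (by fun_prop)).mul (h2.comp (by fun_prop)))
  rw [lintegral_tsum fun δ => (h3 δ).aemeasurable]
  refine tsum_congr fun δ => ?_
  rw [lintegral_smul_measure, lintegral_dirac]
  rw [lintegral_prod_mul (μ := mG) (ν := mH)
    (f := fun g => B.indicator (1 : G × G → ℝ≥0∞) (δ.1.1 * g, g))
    (g := fun h => W.indicator (1 : H → ℝ≥0∞) (δ.1.2 * h) * W.indicator 1 h)
    (h1.comp (by fun_prop)).aemeasurable ((h2.comp (by fun_prop)).mul h2).aemeasurable,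
    mul_comm, smul_eq_mul]
  congr 1
  · rw [← lintegral_indicator_one ((measurable_const_mul _ hW).inter hW)]
    refine lintegral_congr fun h => ?_
    by_cases hh1 : δ.1.2 * h ∈ W <;> by_cases hh2 : h ∈ W <;> simp [Set.indicator, hh1, hh2]
  · rw [← lintegral_indicator_one]
    · rfl
    · exact measurable_prodMk_left (hm hB)

end CutProjectMeasure

/-! ### The autocorrelation as a second moment of linear statistics -/

lemma integral_bind {X Y : Type*} [MeasurableSpace X] [MeasurableSpace Y] {κ : X → Measure Y}
    (hκ : Measurable κ) (P : Measure X) {f : Y → ℂ} (hf : Integrable f (P.bind κ)) :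
    ∫ y, f y ∂(P.bind κ) = ∫ x, ∫ y, f y ∂(κ x) ∂P :=
  ProbabilityTheory.Kernel.integral_comp (κ := ProbabilityTheory.Kernel.const Unit P)
    (η := ⟨κ, hκ⟩) (a := ()) hf

lemma aestronglyMeasurable_integral_bind {X Y : Type*} [MeasurableSpace X] [MeasurableSpace Y]
    {κ : X → Measure Y} (hκ : Measurable κ) (P : Measure X) {f : Y → ℂ}
    (hf : Integrable f (P.bind κ)) : AEStronglyMeasurable (fun x => ∫ y, f y ∂(κ x)) P :=
  (MeasureTheory.Integrable.integral_comp (κ := ProbabilityTheory.Kernel.const Unit P)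
    (η := ⟨κ, hκ⟩) (a := ()) hf).1

section Autocorrelation

variable {G : Type*} [CommGroup G] [TopologicalSpace G] [IsTopologicalGroup G] [T2Space G]
  [LocallyCompactSpace G] [SecondCountableTopology G] [MeasurableSpace G] [BorelSpace G]
  (mG : Measure G) [mG.IsHaarMeasure]

lemma conv_involution (f : G → ℂ) (x : G) :
    conv mG f (involution f) x = ∫ g, f (x * g) * (starRingEnd ℂ) (f g) ∂mG := by
  rw [conv, ← integral_mul_left_eq_self _ x]
  simp [involution]

/-- The shear (x, g) ↦ (xg, g) has a continuous inverse, so the integrand has compact support. -/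
lemma integrable_shear {f : G → ℂ} (hf : Continuous f) (hfc : HasCompactSupport f) (η : Measure G)
    [IsFiniteMeasureOnCompacts η] :
    Integrable (fun p : G × G => f (p.1 * p.2) * (starRingEnd ℂ) (f p.2)) (η.prod mG) := by
  refine Continuous.integrable_of_hasCompactSupport (by fun_prop) ?_
  refine HasCompactSupport.intro
    ((hfc.isCompact.prod hfc.isCompact).image (f := fun p : G × G => (p.1 * p.2⁻¹, p.2))
      (by fun_prop)) fun p hp => ?_
  by_contra h
  refine hp ⟨(p.1 * p.2, p.2), ⟨subset_tsupport _ fun h1 => h (by simp [h1]),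
    subset_tsupport _ fun h1 => h ?_⟩, by simp⟩
  simp only at h1
  simp [h1]

lemma integral_conv_involution {f : G → ℂ} (hf : Continuous f) (hfc : HasCompactSupport f)
    (η : Measure G) [IsFiniteMeasureOnCompacts η] :
    ∫ x, conv mG f (involution f) x ∂η =
      ∫ p, f (p.1 * p.2) * (starRingEnd ℂ) (f p.2) ∂(η.prod mG) := by
  rw [integral_prod _ (integrable_shear mG hf hfc η)]
  simp_rw [conv_involution]

/-- With Haar measure in place of η, integrating over x first decouples the two factors by
translation invariance. This evaluates the term subtracted in the centered autocorrelation. -/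
lemma integral_conv_involution_haar {f : G → ℂ} (hf : Continuous f) (hfc : HasCompactSupport f) :
    ∫ x, conv mG f (involution f) x ∂mG = ((‖∫ x, f x ∂mG‖ ^ 2 : ℝ) : ℂ) := by
  rw [integral_conv_involution mG hf hfc, integral_prod_symm _ (integrable_shear mG hf hfc mG)]
  simp only [integral_mul_const]
  simp_rw [integral_mul_right_eq_self]
  rw [integral_const_mul, integral_conj, Complex.mul_conj, Complex.normSq_eq_norm_sq]

/-- The autocorrelation of a random measure evaluates `f * f*` as a second moment. -/
lemma IsAutocorrelation.integral_conv {Ω : Type*} [MeasurableSpace Ω] {P : Measure Ω}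
    {p : Ω → Measure G} [∀ ω, SFinite (p ω)] (hp : Measurable fun ω => (p ω).prod (p ω))
    {η : Measure G} (hη : IsAutocorrelation mG P p η) {f : G → ℂ} (hf : Continuous f)
    (hfc : HasCompactSupport f) :
    ∫ x, conv mG f (involution f) x ∂η = ((∫ ω, ‖∫ x, f x ∂p ω‖ ^ 2 ∂P : ℝ) : ℂ) := by
  have := hη.1
  have hm : Measurable fun x : G × G => (x.1 * x.2, x.2) := by fun_prop
  have hbind : P.bind (fun ω => (p ω).prod (p ω)) =
      (η.prod mG).map (fun x : G × G => (x.1 * x.2, x.2)) := by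
    ext B hB
    rw [Measure.bind_apply hB hp.aemeasurable]
    exact hη.2 B hB
  have hF : Continuous fun q : G × G => f q.1 * (starRingEnd ℂ) (f q.2) := by fun_prop
  have hint : Integrable (fun q : G × G => f q.1 * (starRingEnd ℂ) (f q.2))
      (P.bind fun ω => (p ω).prod (p ω)) := by
    rw [hbind, integrable_map_measure hF.aestronglyMeasurable hm.aemeasurable]
    exact integrable_shear mG hf hfc η
  have h1 := integral_map (μ := η.prod mG) hm.aemeasurable
    (f := fun q : G × G => f q.1 * (starRingEnd ℂ) (f q.2)) hF.aestronglyMeasurable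
  rw [integral_conv_involution mG hf hfc η]
  simp only at h1
  rw [← h1, ← hbind, integral_bind hp P hint, ← integral_complex_ofReal]
  refine integral_congr_ae (Filter.Eventually.of_forall fun ω => ?_)
  simp only
  rw [integral_prod_mul f (fun y => (starRingEnd ℂ) (f y)), integral_conj, Complex.mul_conj, Complex.normSq_eq_norm_sq]

end Autocorrelation

/-! ### The dual of the quotient -/

section DualLattice

variable {G : Type*} [CommGroup G] [TopologicalSpace G] [IsTopologicalGroup G]
  {H : Type*} [CommGroup H] [TopologicalSpace H] [IsTopologicalGroup H]
  (Γ : Subgroup (G × H))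

/-- The pair of characters of `G` and `H` that a character of the quotient restricts to. -/
def restrictChar (χ : PontryaginDual ((G × H) ⧸ Γ)) : PontryaginDual G × PontryaginDual H :=
  ({ toFun := fun g => χ (((g, 1) : G × H) : (G × H) ⧸ Γ)
     map_one' := map_one χ
     map_mul' := fun a b => by
      rw [← map_mul, ← QuotientGroup.mk_mul, Prod.mk_mul_mk, mul_one]
     continuous_toFun :=
      (map_continuous χ).comp (QuotientGroup.continuous_mk.comp (by fun_prop)) },
   { toFun := fun h => χ (((1, h) : G × H) : (G × H) ⧸ Γ)
     map_one' := map_one χ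
     map_mul' := fun a b => by
      rw [← map_mul, ← QuotientGroup.mk_mul, Prod.mk_mul_mk, mul_one]
     continuous_toFun :=
      (map_continuous χ).comp (QuotientGroup.continuous_mk.comp (by fun_prop)) })

lemma restrictChar_mul (χ : PontryaginDual ((G × H) ⧸ Γ)) (l : G × H) :
    (restrictChar Γ χ).1 l.1 * (restrictChar Γ χ).2 l.2 = χ (l : (G × H) ⧸ Γ) := by
  change χ (((l.1, 1) : G × H) : (G × H) ⧸ Γ) * χ (((1, l.2) : G × H) : (G × H) ⧸ Γ) = _
  rw [← map_mul, ← QuotientGroup.mk_mul, Prod.mk_mul_mk, mul_one, one_mul]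

/-- The dual of the quotient by `Γ` is the dual lattice. -/
lemma bijective_restrictChar : Function.Bijective fun χ : PontryaginDual ((G × H) ⧸ Γ) =>
    (⟨restrictChar Γ χ, fun γ hγ => by
      rw [restrictChar_mul, (QuotientGroup.eq_one_iff γ).2 hγ, map_one]⟩ : dualLattice Γ) := by
  constructor
  · intro χ ψ h
    have h' : restrictChar Γ χ = restrictChar Γ ψ := congrArg Subtype.val h
    refine PontryaginDual.ext fun ω => ?_
    obtain ⟨l, rfl⟩ := QuotientGroup.mk_surjective ω
    rw [← restrictChar_mul, ← restrictChar_mul, h']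
  · rintro ⟨ξ, hξ⟩
    let φ : G × H →* Circle :=
      { toFun := fun l => ξ.1 l.1 * ξ.2 l.2
        map_one' := by simp
        map_mul' := fun a b => by simp [mul_mul_mul_comm] }
    have hφ : Continuous φ :=
      ((map_continuous ξ.1).comp continuous_fst).mul ((map_continuous ξ.2).comp continuous_snd)
    let χ : PontryaginDual ((G × H) ⧸ Γ) :=
      { QuotientGroup.lift Γ φ hξ with
        continuous_toFun := hφ.quotient_lift _ }
    refine ⟨χ, Subtype.ext (Prod.ext ?_ ?_)⟩
    · refine PontryaginDual.ext fun g => ?_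
      change ξ.1 g * ξ.2 1 = ξ.1 g
      simp
    · refine PontryaginDual.ext fun h => ?_
      change ξ.1 1 * ξ.2 h = ξ.2 h
      simp

end DualLattice

/-! ### Fourier coefficients of the process and its diffraction -/

section Diffraction

variable {G : Type*} [CommGroup G] [TopologicalSpace G] [IsTopologicalGroup G] [T2Space G]
  [LocallyCompactSpace G] [SecondCountableTopology G] [MeasurableSpace G] [BorelSpace G]
  {H : Type*} [CommGroup H] [TopologicalSpace H] [IsTopologicalGroup H] [T2Space H]
  [LocallyCompactSpace H] [SecondCountableTopology H] [MeasurableSpace H] [BorelSpace H]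
  (Γ : Subgroup (G × H)) [DiscreteTopology Γ] {W : Set H}
  (hinj : Set.InjOn Prod.fst (Γ : Set (G × H))) (hW : MeasurableSet W)
  (P : Measure ((G × H) ⧸ Γ)) [IsProbabilityMeasure P]
  (mG : Measure G) [mG.IsHaarMeasure] (mH : Measure H) [mH.IsHaarMeasure]

include hinj hW in
lemma integral_process {f : G → ℂ} (hf : Continuous f) (ω : (G × H) ⧸ Γ) :
    ∫ x, f x ∂process Γ W ω =
      ∫ l, f l.1 * W.indicator (fun _ => (1 : ℂ)) l.2 ∂orbitMeasure Γ ω := by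
  rw [process_eq Γ W hinj hW, integral_map measurable_fst.aemeasurable hf.aestronglyMeasurable,
    ← integral_indicator (MeasurableSet.univ.prod hW)]
  congr 1 with l
  by_cases h : l.2 ∈ W <;> simp [Set.indicator, h]

lemma integrable_indicator_one (hW : MeasurableSet W) (hWc : IsCompact (closure W)) :
    Integrable (W.indicator fun _ => (1 : ℂ)) mH :=
  (integrable_indicator_iff hW).2 (integrableOn_const
    (((measure_mono subset_closure).trans_lt hWc.measure_lt_top).ne))

lemma integrable_unfoldMeasure [P.IsMulLeftInvariant] (hΓ : IsLattice (mG.prod mH) Γ)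
    {F : G × H → ℂ} (hF : Integrable F (mG.prod mH)) : Integrable F (unfoldMeasure Γ P) := by
  obtain ⟨hM, h0, -⟩ := unfoldMeasure_eq Γ P (mG.prod mH) hΓ
  rw [hM]
  exact hF.smul_measure (ENNReal.inv_ne_top.2 h0)

/-- A character of the quotient is constant on the coset ω, so it can be moved inside and unfolded
together with F. -/
lemma integral_orbitMeasure_mul_conj_char (F : G × H → ℂ) (χ : PontryaginDual ((G × H) ⧸ Γ))
    (ω : (G × H) ⧸ Γ) :
    (∫ l, F l ∂orbitMeasure Γ ω) * (starRingEnd ℂ) (χ ω : ℂ) =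
      ∫ l, F l * (starRingEnd ℂ) (χ (l : (G × H) ⧸ Γ) : ℂ) ∂orbitMeasure Γ ω := by
  rw [← integral_mul_const]
  refine integral_congr_ae ?_
  filter_upwards [ae_orbitMeasure Γ ω] with l hl
  rw [hl]

/-- The Fourier coefficients of `ω ↦ p_ω(f)`. -/
lemma integral_process_mul_conj_char [P.IsMulLeftInvariant] (hinj : Set.InjOn Prod.fst
    (Γ : Set (G × H))) (hW : MeasurableSet W) (hΓ : IsLattice (mG.prod mH) Γ)
    (hWc : IsCompact (closure W)) {f : G → ℂ} (hf : Continuous f) (hfc : HasCompactSupport f)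
    (χ : PontryaginDual ((G × H) ⧸ Γ)) :
    ∫ ω, (∫ x, f x ∂process Γ W ω) * (starRingEnd ℂ) (χ ω : ℂ) ∂P =
      ((covol (mG.prod mH) Γ)⁻¹.toReal : ℂ) * (fourier mG f (restrictChar Γ χ).1 *
        fourier mH (W.indicator fun _ => (1 : ℂ)) (restrictChar Γ χ).2) := by
  have hfi : Integrable f mG := hf.integrable_of_hasCompactSupport hfc
  have hWi := integrable_indicator_one mH hW hWc
  have hF : Integrable (fun l : G × H =>
      (f l.1 * (starRingEnd ℂ) ((restrictChar Γ χ).1 l.1 : ℂ)) *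
      (W.indicator (fun _ => (1 : ℂ)) l.2 * (starRingEnd ℂ) ((restrictChar Γ χ).2 l.2 : ℂ)))
      (mG.prod mH) :=
    (integrable_mul_conj_char mG hfi _).mul_prod (integrable_mul_conj_char mH hWi _)
  have hFe : ∀ l : G × H, f l.1 * W.indicator (fun _ => (1 : ℂ)) l.2 *
      (starRingEnd ℂ) (χ (l : (G × H) ⧸ Γ) : ℂ) =
      (f l.1 * (starRingEnd ℂ) ((restrictChar Γ χ).1 l.1 : ℂ)) *
      (W.indicator (fun _ => (1 : ℂ)) l.2 * (starRingEnd ℂ) ((restrictChar Γ χ).2 l.2 : ℂ)) := by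
    intro l
    rw [← restrictChar_mul, Circle.coe_mul, map_mul]
    ring
  simp_rw [integral_process Γ hinj hW hf, integral_orbitMeasure_mul_conj_char, hFe]
  rw [← integral_bind (measurable_orbitMeasure Γ) P (integrable_unfoldMeasure Γ P mG mH hΓ hF)]
  change ∫ l, _ ∂unfoldMeasure Γ P = _
  rw [(unfoldMeasure_eq Γ P (mG.prod mH) hΓ).1, integral_smul_measure, integral_prod_mul
    (fun g => f g * (starRingEnd ℂ) ((restrictChar Γ χ).1 g : ℂ))
    (fun h => W.indicator (fun _ => (1 : ℂ)) h * (starRingEnd ℂ) ((restrictChar Γ χ).2 h : ℂ)),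
    Complex.real_smul]
  rfl

/-- The number of points in the support of f is bounded uniformly in ω, so the function is even
bounded. -/
lemma memLp_integral_process [P.IsMulLeftInvariant] (hinj : Set.InjOn Prod.fst
    (Γ : Set (G × H))) (hW : MeasurableSet W) (hΓ : IsLattice (mG.prod mH) Γ)
    (hWc : IsCompact (closure W)) {f : G → ℂ} (hf : Continuous f) (hfc : HasCompactSupport f) :
    MemLp (fun ω => ∫ x, f x ∂process Γ W ω) 2 P := by
  obtain ⟨N, hN⟩ := exists_process_le Γ hinj hW hWc hfc.isCompact
  obtain ⟨C, hC⟩ := hf.bounded_above_of_compact_support hfc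
  refine MemLp.of_bound ?_ (C * N) (Filter.Eventually.of_forall fun ω => ?_)
  · simp_rw [integral_process Γ hinj hW hf]
    have hF : Integrable (fun l : G × H => f l.1 * W.indicator (fun _ => (1 : ℂ)) l.2)
        (mG.prod mH) := (hf.integrable_of_hasCompactSupport hfc).mul_prod
      (integrable_indicator_one mH hW hWc)
    exact aestronglyMeasurable_integral_bind (measurable_orbitMeasure Γ) P
      (integrable_unfoldMeasure Γ P mG mH hΓ hF)
  · have hlt : process Γ W ω (tsupport f) < ∞ := (hN ω).trans_lt (by simp)
    rw [← setIntegral_eq_integral_of_forall_compl_eq_zero (s := tsupport f)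
      fun x hx => image_eq_zero_of_notMem_tsupport hx]
    refine (norm_setIntegral_le_of_norm_le_const hlt fun x _ => hC x).trans ?_
    refine mul_le_mul_of_nonneg_left ?_ ((norm_nonneg _).trans (hC 1))
    exact (ENNReal.toReal_mono (by simp) (hN ω)).trans_eq (ENNReal.toReal_natCast N)

/-- The weight of `ξ` in the spectral sum paired with `|f̂|²`. -/
def spectralWeight (W : Set H) (f : G → ℂ) (ξ : PontryaginDual G × PontryaginDual H) : ℝ :=
  (covol (mG.prod mH) Γ)⁻¹.toReal ^ 2 *
    (‖fourier mH (W.indicator fun _ => (1 : ℂ)) ξ.2‖ ^ 2 * ‖fourier mG f ξ.1‖ ^ 2)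

/-- Parseval's identity for `ω ↦ p_ω(f)`. -/
lemma hasSum_spectralWeight [P.IsMulLeftInvariant] (hinj : Set.InjOn Prod.fst
    (Γ : Set (G × H))) (hW : MeasurableSet W) (hΓ : IsLattice (mG.prod mH) Γ)
    (hWc : IsCompact (closure W)) {f : G → ℂ} (hf : Continuous f) (hfc : HasCompactSupport f) :
    HasSum (fun ξ : dualLattice Γ => spectralWeight Γ mG mH W f ξ)
      (∫ ω, ‖∫ x, f x ∂process Γ W ω‖ ^ 2 ∂P) := by
  have := compactSpace_quotient Γ P
  have : NeZero P := ⟨IsProbabilityMeasure.ne_zero P⟩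
  have := isOpenPosMeasure_of_mulLeftInvariant_of_regular (μ := P)
  have h := hasSum_norm_sq_integral_char P _
    (memLp_integral_process Γ P mG mH hinj hW hΓ hWc hf hfc)
  rw [← (Equiv.ofBijective _ (bijective_restrictChar Γ)).hasSum_iff]
  convert h using 2 with χ
  rw [integral_process_mul_conj_char Γ P mG mH hinj hW hΓ hWc hf hfc, norm_mul, norm_mul, mul_pow,
    mul_pow, Complex.norm_real, Real.norm_of_nonneg ENNReal.toReal_nonneg]
  change _ * (_ * _) = _
  rw [mul_comm (‖fourier mG f _‖ ^ 2)]
  rfl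

lemma fourier_one (f : G → ℂ) : fourier mG f 1 = ∫ x, f x ∂mG := by
  simp [fourier]

lemma IsIntensity.unique {Ω : Type*} [MeasurableSpace Ω] {P : Measure Ω} {p : Ω → Measure G}
    {i j : ℝ≥0} (hi : IsIntensity mG P p i) (hj : IsIntensity mG P p j) : i = j := by
  obtain ⟨K, hK, hK1⟩ := exists_compact_mem_nhds (1 : G)
  have h := (hi K hK.measurableSet).symm.trans (hj K hK.measurableSet)
  rw [ENNReal.mul_left_inj (Measure.measure_pos_of_mem_nhds mG hK1).ne' hK.measure_lt_top.ne] at h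
  exact_mod_cast h

variable [MeasurableSpace (PontryaginDual G)] [BorelSpace (PontryaginDual G)]

lemma lintegral_spectralSum (hcov : covol (mG.prod mH) Γ ≠ 0) (f : G → ℂ)
    {S : Set (PontryaginDual G × PontryaginDual H)} {T : ℝ}
    (hT : HasSum (fun ξ : S => spectralWeight Γ mG mH W f ξ) T) :
    ∫⁻ χ, ENNReal.ofReal (‖fourier mG f χ‖ ^ 2) ∂spectralSum mG mH Γ W S = ENNReal.ofReal T := by
  have hc : ((covol (mG.prod mH) Γ) ^ 2)⁻¹ =
      ENNReal.ofReal ((covol (mG.prod mH) Γ)⁻¹.toReal ^ 2) := by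
    rw [ENNReal.ofReal_pow ENNReal.toReal_nonneg,
      ENNReal.ofReal_toReal (ENNReal.inv_ne_top.2 hcov), ENNReal.inv_pow]
  rw [spectralSum, lintegral_smul_measure, lintegral_sum_measure, hc, smul_eq_mul,
    ← ENNReal.tsum_mul_left, ← hT.tsum_eq,
    ENNReal.ofReal_tsum_of_nonneg (fun ξ => by unfold spectralWeight; positivity) hT.summable]
  refine tsum_congr fun ξ => ?_
  rw [lintegral_smul_measure, lintegral_dirac, smul_eq_mul, spectralWeight,
    ENNReal.ofReal_mul (by positivity), ENNReal.ofReal_mul (by positivity)]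

lemma isFourierTransform_spectralSum (hcov : covol (mG.prod mH) Γ ≠ 0)
    {S : Set (PontryaginDual G × PontryaginDual H)} {Φ : (G → ℂ) → ℂ}
    (hΦ : ∀ f : G → ℂ, Continuous f → HasCompactSupport f →
      ∃ T : ℝ, HasSum (fun ξ : S => spectralWeight Γ mG mH W f ξ) T ∧
        (T : ℂ) = Φ (conv mG f (involution f))) :
    IsFourierTransform mG Φ (spectralSum mG mH Γ W S) := by
  refine ⟨⟨fun K hK => ?_⟩, fun f hf hfc => ?_⟩
  · obtain ⟨f, hf, hfc, hfK⟩ := exists_half_le_norm_fourier mG hK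
    obtain ⟨T, hT, -⟩ := hΦ f hf hfc
    have h := lintegral_spectralSum Γ mG mH hcov f hT
    -- Chebyshev's inequality with |f̂|² ≥ 1/4 on K: finiteness on compact sets follows from the
    -- convergence of the sums.
    have h1 : ENNReal.ofReal (1 / 4) * spectralSum mG mH Γ W S K ≤ ENNReal.ofReal T := by
      rw [← h, ← setLIntegral_const]
      refine (setLIntegral_mono' hK.measurableSet fun χ hχ => ?_).trans
        (setLIntegral_le_lintegral _ _)
      refine ENNReal.ofReal_le_ofReal ?_
      have := hfK χ hχ
      nlinarith
    by_contra htop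
    rw [not_lt_top_iff.1 htop, ENNReal.mul_top (by simp)] at h1
    exact absurd h1 (by simp)
  · obtain ⟨T, hT, hΦT⟩ := hΦ f hf hfc
    have h := lintegral_spectralSum Γ mG mH hcov f hT
    have hfi : Integrable f mG := hf.integrable_of_hasCompactSupport hfc
    have hm : AEStronglyMeasurable (fun χ => ‖fourier mG f χ‖ ^ 2) (spectralSum mG mH Γ W S) :=
      ((continuous_fourier mG hfi).norm.pow 2).aestronglyMeasurable
    have hnn : ∀ χ, 0 ≤ ‖fourier mG f χ‖ ^ 2 := fun χ => by positivity
    refine ⟨⟨hm, ?_⟩, ?_⟩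
    · rw [hasFiniteIntegral_iff_ofReal (Filter.Eventually.of_forall hnn), h]
      exact ENNReal.ofReal_lt_top
    · rw [integral_eq_lintegral_of_nonneg_ae (Filter.Eventually.of_forall hnn) hm, h,
        ENNReal.toReal_ofReal (hT.nonneg fun ξ => by unfold spectralWeight; positivity), hΦT]

include hinj hW in
/-- The spectral sum is the Fourier transform of the autocorrelation. -/
lemma isFourierTransform_autocorrelation [P.IsMulLeftInvariant] (hΓ : IsLattice (mG.prod mH) Γ)
    (hWc : IsCompact (closure W)) {η : Measure G}
    (hη : IsAutocorrelation mG P (process Γ W) η) :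
    IsFourierTransform mG (fun f => ∫ x, f x ∂η)
      (spectralSum mG mH Γ W (dualLattice Γ)) := by
  obtain ⟨-, h0, -⟩ := unfoldMeasure_eq Γ P (mG.prod mH) hΓ
  refine isFourierTransform_spectralSum Γ mG mH h0 fun f hf hfc =>
    ⟨_, hasSum_spectralWeight Γ P mG mH hinj hW hΓ hWc hf hfc, ?_⟩
  exact (hη.integral_conv mG (measurable_process_prod Γ hinj hW) hf hfc).symm

include hinj hW in
/-- Without the trivial character, the spectral sum is the Fourier transform of the centered
autocorrelation. -/
lemma isFourierTransform_centered_autocorrelation [P.IsMulLeftInvariant]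
    (hΓ : IsLattice (mG.prod mH) Γ) (hWc : IsCompact (closure W)) {η : Measure G} {i : ℝ≥0}
    (hη : IsAutocorrelation mG P (process Γ W) η) (hi : IsIntensity mG P (process Γ W) i) :
    IsFourierTransform mG (fun f => ∫ x, f x ∂η - ((i : ℝ) : ℂ) ^ 2 * ∫ x, f x ∂mG)
      (spectralSum mG mH Γ W (dualLattice Γ \ {(1, 1)})) := by
  classical
  obtain ⟨-, h0, -⟩ := unfoldMeasure_eq Γ P (mG.prod mH) hΓ
  obtain rfl := hi.unique mG (isIntensity_process Γ hinj hW P mG mH hΓ hWc)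
  refine isFourierTransform_spectralSum Γ mG mH h0 fun f hf hfc =>
    ⟨(∫ ω, ‖∫ x, f x ∂process Γ W ω‖ ^ 2 ∂P) - spectralWeight Γ mG mH W f (1, 1),
      ?_, ?_⟩
  · have h := hasSum_spectralWeight Γ P mG mH hinj hW hΓ hWc hf hfc
    change HasSum (spectralWeight Γ mG mH W f ∘ Subtype.val) _ at h
    change HasSum (spectralWeight Γ mG mH W f ∘ Subtype.val) _
    rw [hasSum_subtype_iff_indicator] at h
    rw [hasSum_subtype_iff_indicator]
    have h1 : ((1, 1) : PontryaginDual G × PontryaginDual H) ∈ dualLattice Γ := fun γ _ => by simp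
    -- Removing the trivial pair subtracts one term from the Parseval sum; below, this term is
    -- identified with i(p)²|∫ f|².
    have heq : (dualLattice Γ \ {(1, 1)}).indicator (spectralWeight Γ mG mH W f) = fun ξ =>
        (dualLattice Γ).indicator (spectralWeight Γ mG mH W f) ξ -
          if ξ = (1, 1) then spectralWeight Γ mG mH W f (1, 1) else 0 := by
      ext ξ
      by_cases hξ : ξ = (1, 1)
      · subst hξ
        simp [Set.indicator, h1]
      · simp [Set.indicator, hξ]
    rw [heq]
    exact h.sub (hasSum_ite_eq _ _)
  · rw [hη.integral_conv mG (measurable_process_prod Γ hinj hW) hf hfc,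
      integral_conv_involution_haar mG hf hfc]
    have hc : ((((covol (mG.prod mH) Γ)⁻¹ * mH W).toNNReal : ℝ≥0) : ℝ) =
        (covol (mG.prod mH) Γ)⁻¹.toReal * mH.real W := by
      rw [ENNReal.coe_toNNReal_eq_toReal, ENNReal.toReal_mul]
      rfl
    have hWh : ‖fourier mH (W.indicator fun _ => (1 : ℂ)) 1‖ ^ 2 = mH.real W ^ 2 := by
      rw [fourier_one, integral_indicator hW, setIntegral_const]
      simp
    rw [hc, spectralWeight, hWh, fourier_one]
    push_cast
    ring

end Diffraction

end CutProject

end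

theorem mainTheorem10
    {G : Type*} [CommGroup G] [TopologicalSpace G] [IsTopologicalGroup G] [T2Space G]
    [LocallyCompactSpace G] [SecondCountableTopology G] [MeasurableSpace G] [BorelSpace G]
    {H : Type*} [CommGroup H] [TopologicalSpace H] [IsTopologicalGroup H] [T2Space H]
    [LocallyCompactSpace H] [SecondCountableTopology H] [MeasurableSpace H] [BorelSpace H]
    [MeasurableSpace (PontryaginDual G)] [BorelSpace (PontryaginDual G)]
    (mG : Measure G) [mG.IsHaarMeasure] (mH : Measure H) [mH.IsHaarMeasure]
    (Γ : Subgroup (G × H)) (hΓ : CutProject.IsLattice (mG.prod mH) Γ)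
    (hinj : Set.InjOn Prod.fst (Γ : Set (G × H)))
    (hdense : Dense (Prod.snd '' (Γ : Set (G × H))))
    (W : Set H) (hWm : MeasurableSet W) (hWc : IsCompact (closure W))
    (hWi : W ⊆ closure (interior W))
    (P : Measure ((G × H) ⧸ Γ)) [IsProbabilityMeasure P]
    (hP : ∀ g : G, MeasurePreserving (fun ω : (G × H) ⧸ Γ => g • ω) P P) :
    (∀ σ : Measure (PontryaginDual G),
      CutProject.IsDiffraction mG P (CutProject.process Γ W) σ ↔
        σ = CutProject.spectralSum mG mH Γ W (CutProject.dualLattice Γ)) ∧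
    (∀ σ : Measure (PontryaginDual G),
      CutProject.IsCenteredDiffraction mG P (CutProject.process Γ W) σ ↔
        σ = CutProject.spectralSum mG mH Γ W (CutProject.dualLattice Γ \ {(1, 1)})) := by
  have := hΓ.discrete
  have := CutProject.isMulLeftInvariant_of_measurePreserving Γ P hdense hP
  have hp := CutProject.isInvariantRandomMeasure_process Γ hinj hWm P hWc hP
  have hη := CutProject.isAutocorrelation_autocorrelation Γ hinj hWm P mG mH hΓ hWc
  have hi := CutProject.isIntensity_process Γ hinj hWm P mG mH hΓ hWc
  refine ⟨fun σ => ⟨?_, ?_⟩, fun σ => ⟨?_, ?_⟩⟩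
  -- The spectral sum is a Fourier transform of every admissible η, so σ is compared with it
  -- directly, without first proving that η is unique.
  · rintro ⟨-, η, hη, hσ⟩
    exact hσ.unique mG
      (CutProject.isFourierTransform_autocorrelation Γ hinj hWm P mG mH hΓ hWc hη)
  · rintro rfl
    exact ⟨hp, _, hη, CutProject.isFourierTransform_autocorrelation Γ hinj hWm P mG mH hΓ hWc hη⟩
  · rintro ⟨-, η, i, hη, hi, hσ⟩
    exact hσ.unique mG
      (CutProject.isFourierTransform_centered_autocorrelation Γ hinj hWm P mG mH hΓ hWc hη hi)
  · rintro rfl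
    exact ⟨hp, _, _, hη, hi,
      CutProject.isFourierTransform_centered_autocorrelation Γ hinj hWm P mG mH hΓ hWc hη hi⟩
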